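/- All graphs are finite, simple and undirected. For a connected graph $G$ and a weighting $\varphi\colon E(G)\to[0,\infty)$, let $D_{\varphi G}$ be the $V(G)\times V(G)$ matrix whose $(u,v)$ entry is the minimum, over all paths from $u$ to $v$, of the sum of the weights of the edges of the path. For a constant weighting $c$ we write $cG$ for the weighted graph. For $S\subseteq V(G)$ let $\delta(S)$ be the cut metric, with $\delta(S)_{ij}=1$ if exactly one of $i,j$ lies in $S$ and $0$ otherwise. For a semimetric $M=(d(i,j))$ on $V(G)$ and $\emptyset\ne S\subsetneq V(G)$, let $\alpha_M(S)$ be half the minimum, over $a,a'\in S$ and $b,b'\in S^c$, of \[\max\bigl(d(a,b)+d(a',b')-d(a,a')-d(b,b'),\ d(a,b')+d(a',b)-d(a,a')-d(b,b'),\ 0\bigr).\] If $\alpha_M(S)>0$, call $\delta(S)$ an $M$-split; let $\Sigma_M$ be the set of $M$-splits, and put $M_0=M-\sum_{\delta(S)\in\Sigma_M}\alpha_M(S)\,\delta(S)$, each split $\delta(S)=\delta(S^c)$ being counted once. We say that $M$ is totally decomposable if $M_0=0$; that $M'$ is a distance minor of $M$ if, up to relabelling of its indices, $M'$ is a principal submatrix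 of $\lambda_0M_0+\sum_{\delta(S)\in\Sigma_M}\lambda_S\,\delta(S)$ for some real numbers $\lambda_0,\lambda_S\ge 0$; and that $M$ is $\ell_1$-embeddable if there is a map $f$ from $V(G)$ to the space of finitely supported real sequences with $d(u,v)=\|f(u)-f(v)\|_1$ for all $u,v$. Let $i_+(M)$ be the number of positive eigenvalues of $M$, counted with multiplicity. **Theorem.** Let $G$ be a connected graph. The following are equivalent: 1. $G$ has no $K_{2,3}$ graph minor. 2. There are no $\varphi\colon E(G)\to[0,\infty)$ and real $c>0$ such that $D_{cK_{2,3}}$ is a distance minor of $D_{\varphi G}$. 3. For every $\varphi\colon E(G)\to[0,\infty)$, $D_{\varphi G}$ is totally decomposable. 4. For every $\varphi\colon E(G)\to[0,\infty)$, $D_{\varphi G}$ is $\ell_1$-embeddable. 5. For every $\varphi\colon E(G)\to[0,\infty)$ with $D_{\varphi G}\neq 0$, $i_+(D_{\varphi G})=1$. -/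

import Mathlib

open scoped NNReal

noncomputable section

namespace WeightedGraph

/-- `H` is a (graph) minor of `G`: there are nonempty connected, pairwise disjoint branch sets
`B w ⊆ V(G)`, one for each vertex `w` of `H`, such that adjacent vertices of `H` have branch sets
joined by an edge of `G`. (A graph on the empty vertex set is not `Connected` in Mathlib, so
branch sets are nonempty.) -/
def IsGraphMinor {W V : Type*} (H : SimpleGraph W) (G : SimpleGraph V) : Prop :=
  ∃ B : W → Set V,
    (∀ w, (G.induce (B w)).Connected) ∧
    (∀ w w', w ≠ w' → Disjoint (B w) (B w')) ∧
    (∀ w w', H.Adj w w' → ∃ x ∈ B w, ∃ y ∈ B w', G.Adj x y)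

/-- The length of a walk: the sum of the weights of its edges. -/
def walkLength {V : Type*} {G : SimpleGraph V} (φ : G.edgeSet → ℝ≥0) :
    ∀ {u v : V}, G.Walk u v → ℝ
  | _, _, .nil => 0
  | _, _, .cons h p => (φ ⟨s(_, _), G.mem_edgeSet.mpr h⟩ : ℝ) + walkLength φ p

/-- The distance matrix of the weighted graph `φG`: its `(u, v)` entry is the least length of a
path from `u` to `v`. It is used for finite connected graphs, where the infimum is over a
nonempty finite family, hence a minimum. -/
def distanceMatrix {V : Type*} (G : SimpleGraph V) (φ : G.edgeSet → ℝ≥0) : Matrix V V ℝ :=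
  Matrix.of fun u v => ⨅ p : G.Path u v, walkLength φ (p : G.Walk u v)

/-- The infimum in `distanceMatrix` is attained. -/
theorem exists_path_length_eq {V : Type*} [Fintype V] [DecidableEq V] (G : SimpleGraph V)
    (hG : G.Connected) (φ : G.edgeSet → ℝ≥0) (u v : V) :
    ∃ p : G.Path u v, walkLength φ (p : G.Walk u v) = distanceMatrix G φ u v := by
  classical
  have : Nonempty (G.Path u v) := ⟨(hG.preconnected u v).some.toPath⟩
  obtain ⟨p, hp⟩ := exists_eq_ciInf_of_finite
    (f := fun p : G.Path u v => walkLength φ (p : G.Walk u v))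
  exact ⟨p, hp⟩

/-- The cut metric `δ(S)`. -/
def cutMetric {V : Type*} [DecidableEq V] (S : Finset V) : Matrix V V ℝ :=
  Matrix.of fun i j => if (i ∈ S ↔ j ∈ S) then 0 else 1

/-- `α_M(A, B)`: half the minimum, over `a, a' ∈ A` and `b, b' ∈ B`, of
`max (d(a,b) + d(a',b') - d(a,a') - d(b,b'), d(a,b') + d(a',b) - d(a,a') - d(b,b'), 0)`.
If `A` or `B` is empty the value is `0`. -/
def isolationIndexPair {V : Type*} (M : Matrix V V ℝ) (A B : Finset V) : ℝ :=
  (1 / 2) * ⨅ q : (A × A) × (B × B),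
    max (max (M q.1.1 q.2.1 + M q.1.2 q.2.2 - M q.1.1 q.1.2 - M q.2.1 q.2.2)
      (M q.1.1 q.2.2 + M q.1.2 q.2.1 - M q.1.1 q.1.2 - M q.2.1 q.2.2)) 0

/-- The isolation index `α_M(S) = α_M(S, Sᶜ)`. -/
def isolationIndex {V : Type*} [Fintype V] [DecidableEq V] (M : Matrix V V ℝ)
    (S : Finset V) : ℝ :=
  isolationIndexPair M S Sᶜ

/-- The sets `S` for which `δ(S)` is an `M`-split, that is `α_M(S) > 0`. A set and its complement
define the same cut metric, so every `M`-split is given by exactly two members of this family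
(see `cutMetric_eq_iff`). -/
def splitSets {V : Type*} [Fintype V] [DecidableEq V] (M : Matrix V V ℝ) :
    Finset (Finset V) :=
  Finset.univ.filter fun S => 0 < isolationIndex M S

/-- The split-prime part `M₀ = M - ∑ α_M(S) δ(S)` of `M`, where the sum is over the `M`-splits
`δ(S)`. The factor `1/2` makes up for each split being listed twice in `splitSets M`, by `S` and
by `Sᶜ`, with the same isolation index. -/
def splitPrimePart {V : Type*} [Fintype V] [DecidableEq V] (M : Matrix V V ℝ) :
    Matrix V V ℝ :=
  M - (1 / 2 : ℝ) • ∑ S ∈ splitSets M, isolationIndex M S • cutMetric S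

/-- `M` is totally decomposable if its split-prime part vanishes. -/
def TotallyDecomposable {V : Type*} [Fintype V] [DecidableEq V] (M : Matrix V V ℝ) : Prop :=
  splitPrimePart M = 0

/-- `M'` is a (distance) minor of `M`: up to relabelling, `M'` is a principal submatrix of
`λ₀ M₀ + ∑ λ_S δ(S)`, sum over the `M`-splits, for some nonnegative `λ₀` and `λ_S`.
(Listing each split twice does not change the set of these matrices.) -/
def IsDistanceMinor {W V : Type*} [Fintype V] [DecidableEq V] (M' : Matrix W W ℝ)
    (M : Matrix V V ℝ) : Prop :=
  ∃ (l₀ : ℝ≥0) (l : Finset V → ℝ≥0) (f : W ↪ V),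
    M' = ((l₀ : ℝ) • splitPrimePart M +
      ∑ S ∈ splitSets M, (l S : ℝ) • cutMetric S).submatrix f f

/-- `M` is `ℓ₁`-embeddable: there is a distance-preserving map into the space of finitely
supported real sequences with the norm `∑ |a_n|`. -/
def L1Embeddable {V : Type*} (M : Matrix V V ℝ) : Prop :=
  ∃ f : V → (ℕ →₀ ℝ), ∀ u v, M u v = (f u - f v).sum fun _ x => |x|

/-- `i₊(M)`: the number of positive eigenvalues of `M`, with multiplicity. -/
def posInertia {V : Type*} [Fintype V] [DecidableEq V] (M : Matrix V V ℝ) : ℕ :=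
  M.charpoly.roots.countP fun x => 0 < x

theorem cutMetric_eq_iff {V : Type*} [Fintype V] [DecidableEq V] (S T : Finset V) :
    cutMetric S = cutMetric T ↔ S = T ∨ S = Tᶜ := by
  constructor
  · intro h
    have key : ∀ i j, ((i ∈ S ↔ j ∈ S) ↔ (i ∈ T ↔ j ∈ T)) := by
      intro i j
      have := congrFun (congrFun h i) j
      simp only [cutMetric, Matrix.of_apply] at this
      split_ifs at this <;> simp_all
    by_cases hV : ∃ v, (v ∈ S ↔ v ∈ T)
    · obtain ⟨v, hv⟩ := hV
      left
      ext i
      have := key i v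
      tauto
    · right
      ext i
      have := not_exists.mp hV i
      rw [Finset.mem_compl]
      tauto
  · rintro (rfl | rfl)
    · rfl
    · ext i j
      simp only [cutMetric, Matrix.of_apply, Finset.mem_compl, not_iff_not]

theorem isolationIndex_compl {V : Type*} [Fintype V] [DecidableEq V] (M : Matrix V V ℝ)
    (hM : M.IsSymm) (S : Finset V) : isolationIndex M Sᶜ = isolationIndex M S := by
  have comm : ∀ A B : Finset V, isolationIndexPair M A B = isolationIndexPair M B A := by
    intro A B
    unfold isolationIndexPair
    congr 1
    rw [← (Equiv.prodComm (B × B) (A × A)).iInf_comp]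
    congr 1
    funext q
    have hs : ∀ i j, M i j = M j i := fun i j => hM.apply j i
    simp only [Equiv.prodComm_apply, Prod.fst_swap, Prod.snd_swap]
    rw [hs q.2.1 q.1.1, hs q.2.2 q.1.2, hs q.2.1 q.1.2, hs q.2.2 q.1.1]
    congr 2 <;> ring
  unfold isolationIndex
  rw [compl_compl]
  exact comm _ _

end WeightedGraph

end

open WeightedGraph

/-! Call a family of cuts weakly compatible if it does not separate any four points in all three 2+2
ways.

The main work is 1 → 3. It is enough to write the metric as a nonnegative combination of weakly
compatible cuts: the isolation index of `S` is then exactly the total weight carried by `δ(S)`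
(`isolationIndex_eq_sum`), so subtracting all splits leaves zero.

Such a combination is built by induction over vertex sets `A` containing a geodesic between any two
of their points (`weaklyDecomposableOn_of_geodesicOn`). Up to four points any semimetric will do.
Otherwise take a longest cycle in `A`. If it is Hamiltonian, the two geodesics joining opposite
corners of four cyclically ordered vertices must meet: disjoint ones would contain crossing chords,
which give a `K_{2,3}` minor once there are five vertices. So the cycle is a Kalmanson order, and a
metric with such an order is a combination of interval cuts weighted by halved mixed second
differences. If the cycle misses vertices, a component of the rest attaches to it at only one
vertex, since two would give a longer cycle or three internally disjoint paths; the metric is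
additive across this vertex, and the two smaller decompositions are glued there.

The other implications use quadratic forms and one construction. Combinations of cuts embed in `ℓ₁`;
`ℓ₁` metrics are of negative type, hence have one positive eigenvalue if nonzero. Conversely, a
`K_{2,3}` minor can be weighted so that the metric of `K_{2,3}` is a principal submatrix
(`IsGraphMinor.exists_isometric`). This is a distance minor, and its form is positive definite on
the plane of vectors constant on each side, which rules out having exactly one positive eigenvalue.
Distance minors of a totally decomposable metric are again combinations of cuts, so of negative
type, which multiples of the metric of `K_{2,3}` are not. -/

noncomputable section

namespace WeightedGraph

/-! ### Weakly compatible cuts and isolation indices -/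

/-- `S` separates `{a, b}` from `{c, e}`. -/
def SeparatesPairs {V : Type*} (S : Finset V) (a b c e : V) : Prop :=
  (a ∈ S ↔ b ∈ S) ∧ (c ∈ S ↔ e ∈ S) ∧ ¬ (a ∈ S ↔ c ∈ S)

namespace SeparatesPairs
variable {V : Type*} {S : Finset V} {a a' b b' x : V}

theorem symm (h : SeparatesPairs S a a' b b') : SeparatesPairs S b b' a a' :=
  ⟨h.2.1, h.1, fun h' => h.2.2 h'.symm⟩

theorem swap_left (h : SeparatesPairs S a a' b b') : SeparatesPairs S a' a b b' :=
  ⟨h.1.symm, h.2.1, fun h' => h.2.2 (h.1.trans h')⟩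

theorem replace (h : SeparatesPairs S a a' b b') (hx : ¬ (x ∈ S ↔ a ∈ S)) :
    SeparatesPairs S a a' x b := by
  unfold SeparatesPairs at *
  tauto

/-- Here `a'` is forced onto the side of `b`. This is how minimality in `exists_pairs_isolating`
produces the missing pairings. -/
theorem transfer (h : SeparatesPairs S a x b b') (h' : ¬ SeparatesPairs S a a' b b') :
    SeparatesPairs S a x a' b := by
  unfold SeparatesPairs at *
  tauto

end SeparatesPairs

/-- A family of splits is weakly compatible on `A` if no four points of `A` are split by
members of the family in all three ways. -/
def WeaklyCompatibleOn {V ι : Type*} (A : Finset V) (s : ι → Finset V) : Prop :=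
  ∀ a ∈ A, ∀ b ∈ A, ∀ c ∈ A, ∀ e ∈ A, ∀ i j k,
    SeparatesPairs (s i) a b c e → SeparatesPairs (s j) a c b e → ¬ SeparatesPairs (s k) a e b c

/-- On `A`, the matrix `d` is a nonnegative combination of weakly compatible cut metrics. -/
def WeaklyDecomposableOn {V : Type*} [DecidableEq V] (A : Finset V) (d : Matrix V V ℝ) : Prop :=
  ∃ (ι : Type) (_ : Fintype ι) (s : ι → Finset V) (w : ι → ℝ),
    (∀ k, 0 ≤ w k) ∧ (∀ u ∈ A, ∀ v ∈ A, d u v = ∑ k, w k * cutMetric (s k) u v) ∧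
    WeaklyCompatibleOn A s

section
variable {V : Type*}

open Classical in
/-- Total weight of the splits separating `{a, b}` from `{c, e}`. -/
def pairWeight {ι : Type*} [Fintype ι] (s : ι → Finset V) (w : ι → ℝ) (a b c e : V) : ℝ :=
  ∑ k, if SeparatesPairs (s k) a b c e then w k else 0

theorem pairWeight_nonneg {ι : Type*} [Fintype ι] {s : ι → Finset V} {w : ι → ℝ}
    (hw : ∀ k, 0 ≤ w k) (a b c e : V) : 0 ≤ pairWeight s w a b c e :=
  Finset.sum_nonneg fun k _ => by split_ifs <;> simp [hw]

theorem pairWeight_eq_zero {ι : Type*} [Fintype ι] {s : ι → Finset V} {w : ι → ℝ} {a b c e : V}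
    (h : ∀ k, ¬ SeparatesPairs (s k) a b c e) : pairWeight s w a b c e = 0 :=
  Finset.sum_eq_zero fun k _ => if_neg (h k)

variable [DecidableEq V]

open Classical in
theorem cutMetric_four_point (S : Finset V) (a a' b b' : V) :
    cutMetric S a b + cutMetric S a' b' - cutMetric S a a' - cutMetric S b b' =
      2 * (if SeparatesPairs S a a' b b' then 1 else 0) -
      2 * (if SeparatesPairs S a b a' b' then 1 else 0) := by
  by_cases h1 : a ∈ S <;> by_cases h2 : a' ∈ S <;> by_cases h3 : b ∈ S <;> by_cases h4 : b' ∈ S <;>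
    norm_num [cutMetric, SeparatesPairs, h1, h2, h3, h4]

/-- Only cuts dividing the four points 2+2 contribute, and the third pairing cancels. -/
theorem sum_cutMetric_four_point {ι : Type*} [Fintype ι] (s : ι → Finset V) (w : ι → ℝ)
    {d : Matrix V V ℝ} (hd : ∀ u v, d u v = ∑ k, w k * cutMetric (s k) u v) (a a' b b' : V) :
    d a b + d a' b' - d a a' - d b b' =
      2 * pairWeight s w a a' b b' - 2 * pairWeight s w a b a' b' := by
  classical
  simp only [hd, pairWeight, Finset.mul_sum, ← Finset.sum_add_distrib, ← Finset.sum_sub_distrib]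
  refine Finset.sum_congr rfl fun k _ => ?_
  have := cutMetric_four_point (s k) a a' b b'
  calc _ = w k * (cutMetric (s k) a b + cutMetric (s k) a' b' - cutMetric (s k) a a'
        - cutMetric (s k) b b') := by ring
    _ = _ := by rw [this]; split_ifs <;> ring

variable [Fintype V]

theorem four_point_max {ι : Type*} [Fintype ι] {s : ι → Finset V} {w : ι → ℝ}
    (hw : ∀ k, 0 ≤ w k) {d : Matrix V V ℝ} (hd : ∀ u v, d u v = ∑ k, w k * cutMetric (s k) u v)
    (hc : WeaklyCompatibleOn Finset.univ s) (a a' b b' : V) :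
    max (max (d a b + d a' b' - d a a' - d b b') (d a b' + d a' b - d a a' - d b b')) 0 =
      2 * pairWeight s w a a' b b' := by
  have e1 := sum_cutMetric_four_point s w hd a a' b b'
  have e2 := sum_cutMetric_four_point s w hd a a' b' b
  have hs : pairWeight s w a a' b' b = pairWeight s w a a' b b' := by
    unfold pairWeight SeparatesPairs
    refine Finset.sum_congr rfl fun k _ => ?_
    congr 1
    apply propext
    tauto
  have hbb : d b' b = d b b' := by
    simp only [hd, cutMetric, Matrix.of_apply]
    refine Finset.sum_congr rfl fun k _ => ?_
    congr 2
    exact propext ⟨Iff.symm, Iff.symm⟩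
  rw [hs, hbb] at e2
  rw [e1, e2]
  have n1 := pairWeight_nonneg hw a a' b b' (s := s)
  have n2 := pairWeight_nonneg hw a b a' b' (s := s)
  have n3 := pairWeight_nonneg hw a b' a' b (s := s)
  -- The maximum is twice the weight of `a a' | b b'` less the smallest of the three pairing
  -- weights, and weak compatibility makes the smallest one zero.
  have hz : pairWeight s w a a' b b' = 0 ∨ pairWeight s w a b a' b' = 0 ∨
      pairWeight s w a b' a' b = 0 := by
    by_contra! h
    obtain ⟨h1, h2, h3⟩ := h
    have ex : ∀ p q r t, pairWeight s w p q r t ≠ 0 → ∃ k, SeparatesPairs (s k) p q r t := by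
      intro p q r t h
      by_contra! h'
      exact h (pairWeight_eq_zero h')
    obtain ⟨i, hi⟩ := ex _ _ _ _ h1
    obtain ⟨j, hj⟩ := ex _ _ _ _ h2
    obtain ⟨k, hk⟩ := ex _ _ _ _ h3
    exact hc a (by simp) a' (by simp) b (by simp) b' (by simp) i j k hi hj hk
  rcases hz with h | h | h
  · rw [h, max_eq_right]
    · ring
    · rw [max_le_iff]; constructor <;> linarith
  · rw [h, max_eq_left, max_eq_left] <;> first | linarith | skip
    exact le_max_of_le_left (by linarith)
  · rw [h, max_eq_left, max_eq_right] <;> first | linarith | skip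
    exact le_max_of_le_right (by linarith)

theorem exists_pairs_isolating {ι : Type*} [Fintype ι] {s : ι → Finset V}
    (hc : WeaklyCompatibleOn Finset.univ s) (S : Finset V) (hS : S.Nonempty) (hS' : Sᶜ.Nonempty) :
    ∃ a ∈ S, ∃ a' ∈ S, ∃ b ∈ Sᶜ, ∃ b' ∈ Sᶜ,
      ∀ k, SeparatesPairs (s k) a a' b b' → s k = S ∨ s k = Sᶜ := by
  classical
  -- A quadruple separated by as few members as possible works: if some `s k` other than `S`, `Sᶜ`
  -- separated it, a point `x` misplaced by `s k` could be swapped in. Each swap loses `k`, so by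
  -- minimality gains another member; two swaps together with `k` show all three pairings of four
  -- points.
  let N : V × V × V × V → ℕ := fun q =>
    (Finset.univ.filter fun k => SeparatesPairs (s k) q.1 q.2.1 q.2.2.1 q.2.2.2).card
  obtain ⟨⟨a, a', b, b'⟩, hq, hmin⟩ := Finset.exists_min_image (S ×ˢ S ×ˢ Sᶜ ×ˢ Sᶜ) N
    (hS.product (hS.product (hS'.product hS')))
  simp only [Finset.mem_product] at hq
  obtain ⟨ha, ha', hb, hb'⟩ := hq
  refine ⟨a, ha, a', ha', b, hb, b', hb', fun k hk => ?_⟩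
  by_contra! hne
  -- no admissible quadruple is separated by a proper subfamily
  have key : ∀ p ∈ S, ∀ p' ∈ S, ∀ r ∈ Sᶜ, ∀ r' ∈ Sᶜ, ¬ SeparatesPairs (s k) p p' r r' →
      ∃ u, SeparatesPairs (s u) p p' r r' ∧ ¬ SeparatesPairs (s u) a a' b b' := by
    intro p hp p' hp' r hr r' hr' hn
    by_contra! h
    have h1 := hmin (p, p', r, r') (by simp only [Finset.mem_product]; exact ⟨hp, hp', hr, hr'⟩)
    refine absurd h1 (not_le.mpr (Finset.card_lt_card ?_))
    rw [Finset.ssubset_iff_of_subset]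
    · exact ⟨k, by simpa using hk, by simpa using hn⟩
    · intro u hu
      simp only [Finset.mem_filter, Finset.mem_univ, true_and] at hu ⊢
      exact h u hu
  have hx : (∃ x ∈ S, ¬ (x ∈ s k ↔ a ∈ s k)) ∨ ∃ x ∈ Sᶜ, (x ∈ s k ↔ a ∈ s k) := by
    by_contra! h
    obtain ⟨h1, h2⟩ := h
    by_cases hak : a ∈ s k
    · apply hne.1
      ext x
      by_cases hx : x ∈ S
      · have := h1 x hx; tauto
      · have := h2 x (by simpa using hx); tauto
    · apply hne.2
      ext x
      rw [Finset.mem_compl]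
      by_cases hx : x ∈ S
      · have := h1 x hx; tauto
      · have := h2 x (by simpa using hx); tauto
  rcases hx with ⟨x, hx, hxk⟩ | ⟨x, hx, hxk⟩
  · obtain ⟨u, hu, hu'⟩ := key a ha x hx b hb b' hb' fun h => hxk h.1.symm
    obtain ⟨t, ht, ht'⟩ := key a' ha' x hx b hb b' hb' fun h => hxk (hk.1.trans h.1).symm
    exact hc a (by simp) a' (by simp) x (by simp) b (by simp) k u t (hk.replace hxk)
      (hu.transfer hu') (ht.transfer fun h => ht' (h.swap_left)).symm
  · have hxb : ¬ (x ∈ s k ↔ b ∈ s k) := fun h => hk.2.2 (hxk.symm.trans h)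
    obtain ⟨u, hu, hu'⟩ := key a ha a' ha' b hb x hx fun h => hxb h.2.1.symm
    obtain ⟨t, ht, ht'⟩ := key a ha a' ha' b' hb' x hx fun h => hxb (hk.2.1.trans h.2.1).symm
    exact hc b (by simp) b' (by simp) x (by simp) a (by simp) k u t (hk.symm.replace hxb)
      (hu.symm.transfer fun h => hu' h.symm)
      (ht.symm.transfer fun h => ht' (h.swap_left).symm).symm

-- Every cut equal to `δ(S)` separates all admissible quadruples, and some quadruple is separated by
-- no other cut, so the minimum counts precisely the weight on `δ(S)`.
open Classical in
theorem isolationIndex_eq_sum {ι : Type*} [Fintype ι] {s : ι → Finset V} {w : ι → ℝ}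
    (hw : ∀ k, 0 ≤ w k) {d : Matrix V V ℝ} (hd : ∀ u v, d u v = ∑ k, w k * cutMetric (s k) u v)
    (hc : WeaklyCompatibleOn Finset.univ s) (S : Finset V) (hS : S.Nonempty) (hS' : Sᶜ.Nonempty) :
    isolationIndex d S = ∑ k, if s k = S ∨ s k = Sᶜ then w k else 0 := by
  unfold isolationIndex isolationIndexPair
  simp only [four_point_max hw hd hc]
  have : Nonempty S := hS.to_subtype
  have : Nonempty (Sᶜ : Finset V) := hS'.to_subtype
  rw [← Real.mul_iInf_of_nonneg (by norm_num), ← mul_assoc]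
  norm_num
  apply le_antisymm
  · obtain ⟨a, ha, a', ha', b, hb, b', hb', h⟩ := exists_pairs_isolating hc S hS hS'
    refine (ciInf_le (Set.finite_range _).bddBelow
      ((⟨a, ha⟩, ⟨a', ha'⟩), (⟨b, hb⟩, ⟨b', hb'⟩))).trans ?_
    refine Finset.sum_le_sum fun k _ => ?_
    have := h k
    have := hw k
    split_ifs <;> tauto
  · refine le_ciInf fun q => Finset.sum_le_sum fun k _ => ?_
    obtain ⟨⟨⟨a, ha⟩, ⟨a', ha'⟩⟩, ⟨⟨b, hb⟩, ⟨b', hb'⟩⟩⟩ := q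
    have := hw k
    have h : s k = S ∨ s k = Sᶜ → SeparatesPairs (s k) a a' b b' := by
      rw [Finset.mem_compl] at hb hb'
      rintro (h | h) <;> rw [h] <;> simp [SeparatesPairs, ha, ha', hb, hb']
    split_ifs <;> tauto

theorem isolationIndex_nonneg (d : Matrix V V ℝ) (S : Finset V) : 0 ≤ isolationIndex d S := by
  unfold isolationIndex isolationIndexPair
  exact mul_nonneg (by norm_num) (Real.iInf_nonneg fun q => le_max_right _ _)

theorem sum_splitSets (d : Matrix V V ℝ) :
    ∑ S ∈ splitSets d, isolationIndex d S • cutMetric S =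
      ∑ S, isolationIndex d S • cutMetric S := by
  unfold splitSets
  refine Finset.sum_filter_of_ne fun S _ h => ?_
  refine lt_of_le_of_ne (isolationIndex_nonneg d S) fun h0 => h ?_
  rw [← h0, zero_smul]

theorem totallyDecomposable_of_weaklyDecomposableOn {d : Matrix V V ℝ}
    (h : WeaklyDecomposableOn Finset.univ d) : TotallyDecomposable d := by
  classical
  obtain ⟨ι, _, s, w, hw, hd, hc⟩ := h
  have hd : ∀ u v, d u v = ∑ k, w k * cutMetric (s k) u v := fun u v => hd u (by simp) v (by simp)
  unfold TotallyDecomposable splitPrimePart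
  rw [sum_splitSets]
  ext i j
  simp only [Matrix.sub_apply, Matrix.smul_apply, Matrix.sum_apply, smul_eq_mul, Matrix.zero_apply]
  have e : ∀ S : Finset V, isolationIndex d S * cutMetric S i j =
      ∑ k, (if s k = S ∨ s k = Sᶜ then w k * cutMetric (s k) i j else 0) := by
    intro S
    by_cases hS : S.Nonempty ∧ Sᶜ.Nonempty
    · rw [isolationIndex_eq_sum hw hd hc S hS.1 hS.2, Finset.sum_mul]
      refine Finset.sum_congr rfl fun k _ => ?_
      split_ifs with h
      · rw [(cutMetric_eq_iff (s k) S).mpr h]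
      · simp
    · have h0 : cutMetric S i j = 0 := by
        rw [not_and_or, Finset.not_nonempty_iff_eq_empty, Finset.not_nonempty_iff_eq_empty,
          Finset.compl_eq_empty_iff] at hS
        rcases hS with rfl | rfl <;> simp [cutMetric]
      rw [h0, mul_zero, Finset.sum_eq_zero]
      intro k _
      split_ifs with h
      · rw [(cutMetric_eq_iff (s k) S).mpr h, h0, mul_zero]
      · rfl
  rw [Finset.sum_congr rfl fun S _ => e S, Finset.sum_comm, hd i j]
  -- Each cut is met as `s k` and as its complement, which offsets the factor `1/2` in
  -- `splitPrimePart`.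
  have e2 : ∀ k, ∑ S : Finset V, (if s k = S ∨ s k = Sᶜ then w k * cutMetric (s k) i j else 0) =
      2 * (w k * cutMetric (s k) i j) := by
    intro k
    rw [← Finset.sum_filter]
    have : (Finset.univ.filter fun S => s k = S ∨ s k = Sᶜ) = {s k, (s k)ᶜ} := by
      ext S
      simp only [Finset.mem_filter, Finset.mem_univ, true_and, Finset.mem_insert,
        Finset.mem_singleton]
      rw [eq_comm, eq_compl_comm]
    rw [this, Finset.sum_pair, two_mul]
    intro h
    have := congrArg (fun S : Finset V => i ∈ S) h
    simp at this
  simp only [e2, ← Finset.mul_sum]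
  ring

end

/-! ### Kalmanson orders and interval cuts -/

/-- A semimetric, as a matrix. -/
structure IsSemimetric {V : Type*} (d : Matrix V V ℝ) : Prop where
  self : ∀ u, d u u = 0
  symm : ∀ u v, d u v = d v u
  triangle : ∀ u v x, d u x ≤ d u v + d v x

/-- The linear order of the list is a Kalmanson order for `d`. -/
def IsKalmanson {V : Type*} (d : Matrix V V ℝ) (l : List V) : Prop :=
  ∀ a b c e, [a, b, c, e].Sublist l → d a b + d c e ≤ d a c + d b e ∧ d a e + d b c ≤ d a c + d b e

theorem sum_range_mixed_difference (D : ℕ → ℕ → ℝ) (p₀ p₁ q₀ q₁ : ℕ) (hp : p₀ ≤ p₁) (hq : q₀ ≤ q₁) :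
    ∑ p ∈ Finset.Ico p₀ p₁, ∑ q ∈ Finset.Ico q₀ q₁,
      (D p q + D (p + 1) (q + 1) - D p (q + 1) - D (p + 1) q) =
    D p₀ q₀ + D p₁ q₁ - D p₀ q₁ - D p₁ q₀ := by
  have h : ∀ p, ∑ q ∈ Finset.Ico q₀ q₁, (D p q + D (p + 1) (q + 1) - D p (q + 1) - D (p + 1) q) =
      (D (p + 1) q₁ - D p q₁) - (D (p + 1) q₀ - D p q₀) := by
    intro p
    rw [← Finset.sum_Ico_sub (fun q => D (p + 1) q - D p q) hq]
    exact Finset.sum_congr rfl fun q _ => by ring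
  simp only [h]
  rw [← sub_eq_zero, Finset.sum_sub_distrib, Finset.sum_Ico_sub (fun p => D p q₁) hp,
    Finset.sum_Ico_sub (fun p => D p q₀) hp]
  ring

/-- A circular metric on `0, …, n` with `0` and `n` identified is a combination of interval cuts. -/
theorem eq_sum_interval_cuts (n : ℕ) (D : ℕ → ℕ → ℝ) (h0 : ∀ i, D i i = 0)
    (hn : ∀ i, D i n = D 0 i) {i j : ℕ} (hij : i < j) (hj : j < n) :
    D i j = ∑ p ∈ Finset.range n, ∑ q ∈ Finset.range n,
      if p < q then (D p q + D (p + 1) (q + 1) - D p (q + 1) - D (p + 1) q) / 2 *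
        (if (p < i ∧ i ≤ q ↔ p < j ∧ j ≤ q) then 0 else 1) else 0 := by
  set β : ℕ → ℕ → ℝ := fun p q => D p q + D (p + 1) (q + 1) - D p (q + 1) - D (p + 1) q with hβ
  -- The interval `(p, q]` separates `i < j` iff `p < i ≤ q < j` or `i ≤ p < j ≤ q`: two rectangles
  -- of index pairs, over each of which the mixed difference telescopes to the corners.
  have e : ∀ p ∈ Finset.range n, ∀ q ∈ Finset.range n,
      (if p < q then β p q / 2 * (if (p < i ∧ i ≤ q ↔ p < j ∧ j ≤ q) then 0 else 1) else 0) =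
      (if p ∈ Finset.Ico 0 i then (if q ∈ Finset.Ico i j then β p q / 2 else 0) else 0) +
      (if p ∈ Finset.Ico i j then (if q ∈ Finset.Ico j n then β p q / 2 else 0) else 0) := by
    intro p hp q hq
    simp only [Finset.mem_Ico, Finset.mem_range] at *
    split_ifs <;> first | (exfalso; omega) | simp
  rw [Finset.sum_congr rfl fun p hp => Finset.sum_congr rfl fun q hq => e p hp q hq]
  simp only [Finset.sum_add_distrib]
  have r : ∀ a b c f : ℕ, b ≤ n → f ≤ n → ∑ p ∈ Finset.range n, ∑ q ∈ Finset.range n,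
      (if p ∈ Finset.Ico a b then (if q ∈ Finset.Ico c f then β p q / 2 else 0) else 0) =
      (∑ p ∈ Finset.Ico a b, ∑ q ∈ Finset.Ico c f, β p q) / 2 := by
    intro a b c f hb hf
    have fil : ∀ a b : ℕ, b ≤ n → (Finset.range n).filter (fun p => p ∈ Finset.Ico a b) = Finset.Ico a b := by
      intro a b hb
      ext p
      simp only [Finset.mem_filter, Finset.mem_range, Finset.mem_Ico]
      omega
    rw [Finset.sum_div, ← fil a b hb, Finset.sum_filter]
    refine Finset.sum_congr rfl fun p _ => ?_
    rw [fil a b hb]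
    split_ifs
    · rw [← Finset.sum_filter, fil c f hf, Finset.sum_div]
    · simp
  rw [r _ _ _ _ (by omega) (by omega), r _ _ _ _ (by omega) le_rfl,
    sum_range_mixed_difference D _ _ _ _ (by omega) (by omega),
    sum_range_mixed_difference D _ _ _ _ (by omega) (by omega), h0, h0, hn, hn]
  ring

/-- An interval separating `a, b` from `c, e` forces the two pairs not to cross. -/
theorem not_crossing_of_interval {a b c e p q : ℕ}
    (h : (p < a ∧ a ≤ q ↔ p < b ∧ b ≤ q) ∧ (p < c ∧ c ≤ q ↔ p < e ∧ e ≤ q) ∧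
      ¬ (p < a ∧ a ≤ q ↔ p < c ∧ c ≤ q)) :
    ((c < a ∧ c < b ∨ a < c ∧ b < c) ∧ (e < a ∧ e < b ∨ a < e ∧ b < e)) ∨
    ((a < c ∧ a < e ∨ c < a ∧ e < a) ∧ (b < c ∧ b < e ∨ c < b ∧ e < b)) := by
  omega

/-- Of the three ways to pair up four distinct points on a line, one crosses. -/
theorem false_of_three_not_crossing {a b c e : ℕ}
    (h : ((c < a ∧ c < b ∨ a < c ∧ b < c) ∧ (e < a ∧ e < b ∨ a < e ∧ b < e)) ∨
      ((a < c ∧ a < e ∨ c < a ∧ e < a) ∧ (b < c ∧ b < e ∨ c < b ∧ e < b)))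
    (h' : ((b < a ∧ b < c ∨ a < b ∧ c < b) ∧ (e < a ∧ e < c ∨ a < e ∧ c < e)) ∨
      ((a < b ∧ a < e ∨ b < a ∧ e < a) ∧ (c < b ∧ c < e ∨ b < c ∧ e < c)))
    (h'' : ((b < a ∧ b < e ∨ a < b ∧ e < b) ∧ (c < a ∧ c < e ∨ a < c ∧ e < c)) ∨
      ((a < b ∧ a < c ∨ b < a ∧ c < a) ∧ (e < b ∧ e < c ∨ b < e ∧ c < e))) : False := by
  omega

/-- A semimetric with a Kalmanson order is weakly decomposable. -/
theorem IsKalmanson.weaklyDecomposableOn {V : Type*} [DecidableEq V] {d : Matrix V V ℝ}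
    (hd : IsSemimetric d) {l : List V} (hl : l.Nodup) (h : IsKalmanson d l) :
    WeaklyDecomposableOn l.toFinset d := by
  classical
  rcases Nat.eq_zero_or_pos l.length with h0 | hpos
  · rw [List.length_eq_zero_iff] at h0
    subst h0
    exact ⟨Empty, inferInstance, Empty.elim, Empty.elim, fun k => k.elim, by simp, by
      intro a ha; simp at ha⟩
  set n := l.length with hn
  let x : ℕ → V := fun i => l[i % n]'(Nat.mod_lt _ hpos)
  have hx : ∀ i (hi : i < n), x i = l[i] := fun i hi => by simp only [x, Nat.mod_eq_of_lt hi]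
  have hxn : x n = x 0 := by simp [x]
  -- Coincident indices reduce this to the triangle inequality or a tautology. The wrap-around `m =
  -- n` is the other Kalmanson inequality, read at `0, i, j, k`.
  have hK : ∀ i j k m, i ≤ j → j ≤ k → k ≤ m → m ≤ n →
      d (x i) (x m) + d (x j) (x k) ≤ d (x i) (x k) + d (x j) (x m) := by
    intro i j k m hij hjk hkm hmn
    rcases hij.eq_or_lt with rfl | hij
    · linarith
    rcases hkm.eq_or_lt with rfl | hkm
    · linarith
    rcases hjk.eq_or_lt with rfl | hjk
    · have := hd.triangle (x i) (x j) (x m)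
      have := hd.self (x j)
      linarith
    have hsub : ∀ i j k m (hij : i < j) (hjk : j < k) (hkm : k < m) (hm : m < n),
        [x i, x j, x k, x m].Sublist l := by
      intro i j k m hij hjk hkm hm
      rw [hx _ (by omega), hx _ (by omega), hx _ (by omega), hx _ (by omega)]
      rw [List.sublist_iff_exists_fin_orderEmbedding_get_eq]
      refine ⟨OrderEmbedding.ofStrictMono ![⟨i, by omega⟩, ⟨j, by omega⟩, ⟨k, by omega⟩, ⟨m, by omega⟩] ?_, ?_⟩
      · intro a b hab
        change Fin 4 at a b
        fin_cases a <;> fin_cases b <;> simp at hab ⊢ <;> omega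
      · intro a
        change Fin 4 at a
        fin_cases a <;> rfl
    rcases hmn.eq_or_lt with rfl | hmn
    · rw [hxn]
      rcases Nat.eq_zero_or_pos i with rfl | hi
      · have := hd.triangle (x j) (x 0) (x k)
        have := hd.self (x 0)
        linarith
      · have := (h _ _ _ _ (hsub 0 i j k hi hij hjk hkm)).1
        rw [hd.symm (x i) (x 0), hd.symm (x j) (x 0)]
        linarith
    · exact (h _ _ _ _ (hsub i j k m hij hjk hkm hmn)).2
  have hmem : ∀ u ∈ l.toFinset, ∃ i < n, x i = u := by
    intro u hu
    rw [List.mem_toFinset] at hu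
    obtain ⟨i, hi, rfl⟩ := List.getElem_of_mem hu
    exact ⟨i, hi, hx i hi⟩
  have hinj : ∀ i < n, ∀ j < n, x i = x j → i = j := by
    intro i hi j hj hij
    rw [hx i hi, hx j hj] at hij
    exact (hl.getElem_inj_iff).mp hij
  let s : Fin n × Fin n → Finset V := fun k =>
    ((Finset.range n).filter fun i : ℕ => (k.1 : ℕ) < i ∧ i ≤ k.2).image x
  have hs : ∀ k : Fin n × Fin n, ∀ i < n, (x i ∈ s k ↔ (k.1 : ℕ) < i ∧ i ≤ k.2) := by
    intro k i hi
    simp only [s, Finset.mem_image, Finset.mem_filter, Finset.mem_range]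
    constructor
    · rintro ⟨j, ⟨hj, hj'⟩, hji⟩
      rwa [← hinj j hj i hi hji]
    · exact fun h => ⟨i, ⟨hi, h⟩, rfl⟩
  let w : Fin n × Fin n → ℝ := fun k => if (k.1 : ℕ) < k.2 then
    (d (x k.1) (x k.2) + d (x (k.1 + 1)) (x (k.2 + 1)) - d (x k.1) (x (k.2 + 1)) -
      d (x (k.1 + 1)) (x k.2)) / 2 else 0
  refine ⟨Fin n × Fin n, inferInstance, s, w, ?_, ?_, ?_⟩
  · intro k
    simp only [w]
    split_ifs with hk
    · have := hK k.1 (k.1 + 1) k.2 (k.2 + 1) (by omega) (by omega) (by omega) (by omega)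
      linarith
    · exact le_rfl
  · have main : ∀ i j, i < j → j < n →
        d (x i) (x j) = ∑ k, w k * cutMetric (s k) (x i) (x j) := by
      intro i j hij hj
      have e := eq_sum_interval_cuts n (fun i j => d (x i) (x j)) (fun i => hd.self _)
        (fun i => by rw [hxn, hd.symm]) hij hj
      rw [e, Fintype.sum_prod_type, Finset.sum_range]
      refine Finset.sum_congr rfl fun p _ => ?_
      rw [Finset.sum_range]
      refine Finset.sum_congr rfl fun q _ => ?_
      simp only [w, cutMetric, Matrix.of_apply, hs (p, q) i (by omega), hs (p, q) j hj]
      split_ifs <;> simp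
    intro u hu v hv
    obtain ⟨i, hi, rfl⟩ := hmem u hu
    obtain ⟨j, hj, rfl⟩ := hmem v hv
    rcases lt_trichotomy i j with hij | rfl | hij
    · exact main i j hij hj
    · simp [cutMetric, hd.self]
    · rw [hd.symm, main j i hij hi]
      refine Finset.sum_congr rfl fun k _ => ?_
      simp only [cutMetric, Matrix.of_apply]
      congr 2
      exact propext ⟨Iff.symm, Iff.symm⟩
  · intro a ha b hb c hc e he k k' k'' h1 h2 h3
    obtain ⟨a, ha', rfl⟩ := hmem a ha
    obtain ⟨b, hb', rfl⟩ := hmem b hb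
    obtain ⟨c, hc', rfl⟩ := hmem c hc
    obtain ⟨e, he', rfl⟩ := hmem e he
    unfold SeparatesPairs at h1 h2 h3
    rw [hs _ _ ha', hs _ _ hb', hs _ _ hc', hs _ _ he'] at h1 h2 h3
    exact false_of_three_not_crossing (not_crossing_of_interval h1) (not_crossing_of_interval h2)
      (not_crossing_of_interval h3)

/-- A semimetric on at most four points has a Kalmanson order. -/
theorem exists_isKalmanson_of_card_le_four {V : Type*} [DecidableEq V] {d : Matrix V V ℝ}
    (hd : IsSemimetric d) (A : Finset V) (hA : A.card ≤ 4) :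
    ∃ l : List V, l.Nodup ∧ l.toFinset = A ∧ IsKalmanson d l := by
  rcases hA.lt_or_eq with hA | hA
  · refine ⟨A.toList, A.nodup_toList, A.toList_toFinset, fun a b c e h => ?_⟩
    have := h.length_le
    simp at this
    omega
  · have four : ∀ a b c e : V, A.toList.Perm [a, b, c, e] → d a b + d c e ≤ d a c + d b e →
        d a e + d b c ≤ d a c + d b e → ∃ l : List V, l.Nodup ∧ l.toFinset = A ∧ IsKalmanson d l := by
      intro a b c e hp h1 h2
      refine ⟨[a, b, c, e], hp.nodup_iff.mp A.nodup_toList, ?_, ?_⟩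
      · rw [← List.toFinset_eq_of_perm _ _ hp, A.toList_toFinset]
      · intro a' b' c' e' h
        have := h.eq_of_length rfl
        simp only [List.cons.injEq] at this
        obtain ⟨rfl, rfl, rfl, rfl, _⟩ := this
        exact ⟨h1, h2⟩
    obtain ⟨a, b, c, e, hl⟩ : ∃ a b c e, A.toList = [a, b, c, e] := by
      have : A.toList.length = 4 := by simpa using hA
      match h : A.toList, this with
      | [a, b, c, e], _ => exact ⟨a, b, c, e, rfl⟩
    have s1 := hd.symm b c
    have s2 := hd.symm c e
    have s3 := hd.symm b e
    -- The pairing with the largest sum becomes the pair of diagonals; the three orders realise the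
    -- three choices.
    by_cases h1 : d a b + d c e ≤ d a c + d b e ∧ d a e + d b c ≤ d a c + d b e
    · exact four a b c e (hl ▸ .refl _) h1.1 h1.2
    by_cases h2 : d a c + d b e ≤ d a b + d c e ∧ d a e + d c b ≤ d a b + d c e
    · exact four a c b e (hl ▸ .cons _ (.swap _ _ _)) h2.1 h2.2
    · refine four a b e c (hl ▸ .cons _ (.cons _ (.swap _ _ _))) ?_ ?_ <;>
      · by_contra h3
        rw [not_and_or, not_le, not_le] at h1 h2
        rcases h1 with h1 | h1 <;> rcases h2 with h2 | h2 <;> linarith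

/-! ### Walks inside vertex sets, cycles and `K_{2,3}` minors -/

section
variable {V : Type*}

/-- Some walk of `G` from `u` to `v` stays in `B`. -/
def WalkJoined (G : SimpleGraph V) (B : Set V) (u v : V) : Prop :=
  ∃ p : G.Walk u v, ∀ z ∈ p.support, z ∈ B

namespace WalkJoined
variable {G : SimpleGraph V} {B C : Set V} {u v x : V}

theorem refl (h : u ∈ B) : WalkJoined G B u u := ⟨.nil, by simpa using h⟩

theorem mem_left (h : WalkJoined G B u v) : u ∈ B := h.choose_spec u (by simp)

theorem mem_right (h : WalkJoined G B u v) : v ∈ B := h.choose_spec v (by simp)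

theorem symm (h : WalkJoined G B u v) : WalkJoined G B v u := by
  obtain ⟨p, hp⟩ := h
  exact ⟨p.reverse, by simpa using hp⟩

theorem trans (h : WalkJoined G B u v) (h' : WalkJoined G B v x) : WalkJoined G B u x := by
  obtain ⟨p, hp⟩ := h
  obtain ⟨q, hq⟩ := h'
  refine ⟨p.append q, fun z hz => ?_⟩
  rw [SimpleGraph.Walk.mem_support_append_iff] at hz
  exact hz.elim (hp z) (hq z)

theorem mono (hBC : B ⊆ C) (h : WalkJoined G B u v) : WalkJoined G C u v :=
  ⟨h.choose, fun z hz => hBC (h.choose_spec z hz)⟩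

theorem of_adj (h : G.Adj u v) (hu : u ∈ B) (hv : v ∈ B) : WalkJoined G B u v :=
  ⟨h.toWalk, by simp [hu, hv]⟩

theorem exists_boundary (h : WalkJoined G B u v) (S : Set V) (hu : u ∈ S) (hv : v ∉ S) :
    ∃ x ∈ B, ∃ y ∈ B, x ∈ S ∧ y ∉ S ∧ G.Adj x y := by
  obtain ⟨p, hp⟩ := h
  obtain ⟨e, he, h1, h2⟩ := p.exists_boundary_dart S hu hv
  exact ⟨e.fst, hp _ (p.dart_fst_mem_support_of_mem_darts he), e.snd,
    hp _ (p.dart_snd_mem_support_of_mem_darts he), h1, h2, e.adj⟩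

theorem map (f : V → V)
    (hf : ∀ x ∈ B, ∀ y ∈ B, G.Adj x y → f x = f y ∨ G.Adj (f x) (f y)) (hC : ∀ x ∈ B, f x ∈ C)
    (h : WalkJoined G B u v) : WalkJoined G C (f u) (f v) := by
  obtain ⟨p, hp⟩ := h
  induction p with
  | nil => exact refl (hC _ (hp _ (by simp)))
  | @cons a b c hab p ih =>
    have ha : a ∈ B := hp _ (by simp)
    have hb : b ∈ B := hp _ (by simp)
    have := ih fun z hz => hp z (by simp [hz])
    rcases hf a ha b hb hab with h | h
    · rwa [h]
    · exact (of_adj h (hC _ ha) (hC _ hb)).trans this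

theorem component (h : WalkJoined G B u v) : WalkJoined G {z | WalkJoined G B u z} u v := by
  classical
  obtain ⟨p, hp⟩ := h
  refine ⟨p, fun z hz => ⟨p.takeUntil z hz, fun y hy => hp y ?_⟩⟩
  exact p.support_takeUntil_subset_support hz hy

theorem exists_chain (h : WalkJoined G B u v) {y : V} (hx : G.Adj x u) (hy : G.Adj v y) :
    ∃ l : List V, l ≠ [] ∧ l.Nodup ∧ (∀ z ∈ l, z ∈ B) ∧ (x :: l ++ [y]).IsChain G.Adj := by
  classical
  obtain ⟨p, hp⟩ := h
  refine ⟨p.bypass.support, by simp, p.bypass_isPath.support_nodup,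
    fun z hz => hp z (p.support_bypass_subset_support hz), ?_⟩
  have := ((SimpleGraph.Walk.cons hx p.bypass).concat hy).isChain_adj_support
  rwa [SimpleGraph.Walk.support_concat, SimpleGraph.Walk.support_cons] at this

end WalkJoined

theorem connected_induce_of_walkJoined {G : SimpleGraph V} {B : Set V} {u : V}
    (h : ∀ x ∈ B, WalkJoined G B u x) (hu : u ∈ B) : (G.induce B).Connected := by
  have : Nonempty B := ⟨⟨u, hu⟩⟩
  refine ⟨fun ⟨x, hx⟩ ⟨y, hy⟩ => ?_⟩
  obtain ⟨p, hp⟩ := (h x hx).symm.trans (h y hy)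
  exact ⟨p.induce B hp⟩

theorem walkJoined_of_isChain {G : SimpleGraph V} (l : List V) (a : V)
    (h : (a :: l).IsChain G.Adj) : ∀ x ∈ a :: l, WalkJoined G {z | z ∈ a :: l} a x := by
  induction l generalizing a with
  | nil =>
    intro x hx
    rw [List.mem_singleton] at hx
    subst hx
    exact .refl (by simp)
  | cons b l ih =>
    rw [List.isChain_cons_cons] at h
    intro x hx
    rcases List.mem_cons.mp hx with rfl | hx
    · exact .refl (by simp)
    · exact (WalkJoined.of_adj h.1 (by simp) (by simp)).trans
        ((ih b h.2 x hx).mono fun z hz => List.mem_cons_of_mem _ hz)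

theorem connected_induce_of_isChain {G : SimpleGraph V} (l : List V) (hl : l ≠ [])
    (h : l.IsChain G.Adj) : (G.induce {z | z ∈ l}).Connected := by
  cases l with
  | nil => exact absurd rfl hl
  | cons a l => exact connected_induce_of_walkJoined (walkJoined_of_isChain l a h) (by simp)

/-- Three internally disjoint paths of length at least two between `x` and `y`. -/
theorem isGraphMinor_of_three_paths {G : SimpleGraph V} {x y : V} {a b c : List V}
    (ha : a ≠ []) (hb : b ≠ []) (hc : c ≠ []) (ca : (x :: a ++ [y]).IsChain G.Adj)
    (cb : (x :: b ++ [y]).IsChain G.Adj) (cc : (x :: c ++ [y]).IsChain G.Adj)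
    (hn : (x :: y :: (a ++ b ++ c)).Nodup) :
    IsGraphMinor (completeBipartiteGraph (Fin 2) (Fin 3)) G := by
  have nb : ∀ l : List V, l ≠ [] → (x :: l ++ [y]).IsChain G.Adj →
      (∃ z ∈ l, G.Adj x z) ∧ (∃ z ∈ l, G.Adj z y) ∧ l.IsChain G.Adj := by
    intro l hl h
    refine ⟨?_, ?_, ?_⟩
    · cases l with
      | nil => exact absurd rfl hl
      | cons z l =>
        simp only [List.cons_append, List.isChain_cons_cons] at h
        exact ⟨z, by simp, h.1⟩
    · obtain ⟨l, z, rfl⟩ := List.eq_nil_or_concat l |>.resolve_left hl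
      refine ⟨z, by simp, ?_⟩
      have : (x :: l ++ z :: y :: []).IsChain G.Adj := by simpa using h
      exact (List.isChain_append_cons_cons.mp this).2.1
    · exact (List.IsChain.left_of_append (l₂ := [y]) (by simpa using h.tail))
  obtain ⟨⟨xa, hxa, xa'⟩, ⟨ya, hya, ya'⟩, ca⟩ := nb a ha ca
  obtain ⟨⟨xb, hxb, xb'⟩, ⟨yb, hyb, yb'⟩, cb⟩ := nb b hb cb
  obtain ⟨⟨xc, hxc, xc'⟩, ⟨yc, hyc, yc'⟩, cc⟩ := nb c hc cc
  simp only [List.nodup_cons, List.mem_cons, List.mem_append, List.nodup_append, not_or] at hn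
  -- The two ends are singleton branch sets, and the three path interiors are the others.
  let f : Fin 2 ⊕ Fin 3 → List V := Sum.elim ![[x], [y]] ![a, b, c]
  have key : ∀ i j, ∃ z ∈ f (.inl i), ∃ t ∈ f (.inr j), G.Adj z t := by
    intro i j
    fin_cases i <;> fin_cases j <;> simp only [f, Sum.elim_inl, Sum.elim_inr]
    · exact ⟨x, by simp, xa, by simpa using hxa, xa'⟩
    · exact ⟨x, by simp, xb, by simpa using hxb, xb'⟩
    · exact ⟨x, by simp, xc, by simpa using hxc, xc'⟩
    · exact ⟨y, by simp, ya, by simpa using hya, ya'.symm⟩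
    · exact ⟨y, by simp, yb, by simpa using hyb, yb'.symm⟩
    · exact ⟨y, by simp, yc, by simpa using hyc, yc'.symm⟩
  refine ⟨fun i => {z | z ∈ f i}, ?_, ?_, ?_⟩
  · rintro (i | i)
    · fin_cases i <;> exact connected_induce_of_isChain _ (by simp [f]) (by simp [f])
    · fin_cases i <;> exact connected_induce_of_isChain _ (by simpa [f]) (by simpa [f])
  · intro i j hij
    rw [Set.disjoint_left]
    intro z hz hz'
    change z ∈ f i at hz
    change z ∈ f j at hz'
    obtain ⟨⟨hxy, ⟨hxA, hxB⟩, hxC⟩, ⟨⟨hyA, hyB⟩, hyC⟩, ⟨_, _, hAB⟩, _, hABC⟩ := hn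
    have h1 := hAB z
    have h2 := hABC z
    rcases i with i | i <;> rcases j with j | j <;> fin_cases i <;> fin_cases j <;>
      simp [f] at hz hz' hij <;> grind
  · rintro (i | i) (j | j) h
    · simp at h
    · exact key i j
    · obtain ⟨z, hz, t, ht, h⟩ := key j i
      exact ⟨t, ht, z, hz, h.symm⟩
    · simp at h

/-- A list of distinct vertices, cyclically consecutive ones being adjacent. A single edge counts
as a cycle of length two. -/
structure IsCycleList (G : SimpleGraph V) (l : List V) : Prop where
  nodup : l.Nodup
  chain : (l : Cycle V).Chain G.Adj
  ne_nil : l ≠ []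

namespace IsCycleList
variable {G : SimpleGraph V}

theorem rotate {l l' : List V} (h : IsCycleList G (l ++ l')) : IsCycleList G (l' ++ l) := by
  refine ⟨List.nodup_append_comm.mp h.nodup, ?_, fun e => h.ne_nil ?_⟩
  · have : ((l' ++ l : List V) : Cycle V) = (l ++ l' : List V) :=
      Cycle.coe_eq_coe.mpr List.isRotated_append
    rw [this]
    exact h.chain
  · rw [List.append_eq_nil_iff] at e ⊢
    exact e.symm

theorem isChain {a : V} {l : List V} (h : IsCycleList G (a :: l)) :
    (a :: l ++ [a]).IsChain G.Adj :=
  (Cycle.chain_coe_cons _ _ _).mp h.chain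

theorem of_edge {a b : V} (h : G.Adj a b) : IsCycleList G [a, b] :=
  ⟨by simp [h.ne], (Cycle.chain_coe_cons _ _ _).mpr (by simp [h, h.symm]), by simp⟩

theorem extend {a b : V} {l k : List V} (h : IsCycleList G (a :: l ++ [b])) (hk : k.Nodup)
    (hc : (b :: k ++ [a]).IsChain G.Adj) (hd : ∀ z ∈ a :: l ++ [b], z ∉ k) :
    IsCycleList G (a :: l ++ [b] ++ k) := by
  refine ⟨List.Nodup.append h.nodup hk fun z hz hz' => hd z hz hz', ?_, by simp⟩
  have h1 : (a :: l ++ [b]).IsChain G.Adj :=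
    List.IsChain.left_of_append (l₂ := [a]) (by simpa using h.isChain)
  have := List.IsChain.append_overlap (l₁ := a :: l) (l₂ := [b]) (l₃ := k ++ [a]) h1
    (by simpa using hc) (by simp)
  exact (Cycle.chain_coe_cons _ _ _).mpr (by simpa using this)

/-- Attaching a path to two vertices of a cycle gives a longer cycle or a `K_{2,3}` minor. -/
theorem longer_or_minor {x y : V} {l l' k : List V} (h : IsCycleList G (x :: l ++ y :: l'))
    (hne : k ≠ []) (hk : k.Nodup) (hc : (x :: k ++ [y]).IsChain G.Adj)
    (hd : ∀ z ∈ x :: l ++ y :: l', z ∉ k) :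
    (∃ m, IsCycleList G m ∧ m.length = (x :: l ++ y :: l').length + k.length ∧
      ∀ z ∈ m, z ∈ x :: l ++ y :: l' ∨ z ∈ k) ∨
    IsGraphMinor (completeBipartiteGraph (Fin 2) (Fin 3)) G := by
  have rev : ∀ {a b : V} {m : List V}, (a :: m ++ [b]).IsChain G.Adj →
      (b :: m.reverse ++ [a]).IsChain G.Adj := by
    intro a b m hm
    have : ((a :: m ++ [b]).reverse).IsChain G.Adj :=
      List.isChain_reverse.mpr (hm.imp fun _ _ h => h.symm)
    simpa using this
  -- If one arc between `x` and `y` is a bare edge, `k` replaces it and lengthens the cycle;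
  -- otherwise both arcs and `k` are the three paths.
  by_cases hl : l = []
  · subst hl
    left
    have h' : IsCycleList G (y :: l' ++ [x]) := IsCycleList.rotate (l := [x]) (by simpa using h)
    refine ⟨_, h'.extend hk hc fun z hz => hd z ?_, ?_, ?_⟩
    · simp at hz ⊢; tauto
    · simp; omega
    · intro z hz; simp at hz ⊢; tauto
  by_cases hl' : l' = []
  · subst hl'
    left
    refine ⟨_, h.extend (k := k.reverse) (by simpa using hk) (rev hc) fun z hz => ?_, ?_, ?_⟩
    · simpa using hd z hz
    · simp; omega
    · intro z hz; simp at hz ⊢; tauto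
  · right
    have h' : IsCycleList G ((y :: l') ++ (x :: l)) := h.rotate
    have c1 : (x :: l ++ [y]).IsChain G.Adj :=
      List.IsChain.left_of_append (l₂ := l' ++ [x]) (by simpa using h.isChain)
    have c2 : (y :: l' ++ [x]).IsChain G.Adj :=
      List.IsChain.left_of_append (l₂ := l ++ [y]) (by simpa using IsCycleList.isChain (l := l' ++ x :: l) h')
    refine isGraphMinor_of_three_paths hl (b := l'.reverse) (by simpa using hl') hne c1 (rev c2) hc ?_
    have hn := h.nodup
    have := List.Nodup.append hn hk fun z hz hz' => hd z hz hz'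
    refine (List.Perm.nodup_iff ?_).mp this
    classical
    rw [List.perm_iff_count]
    intro z
    simp [List.count_cons]
    omega

end IsCycleList
end

/-! ### Crossing chords, Hamiltonian cycles and gluing -/

section
variable {V : Type*}

/-- Two crossing chords of a cycle of length at least five give a `K_{2,3}` minor. -/
theorem isGraphMinor_of_crossing_chords {G : SimpleGraph V} {p q p' q' : V} {a b c e : List V}
    (h : IsCycleList G (p :: a ++ q :: b ++ p' :: c ++ q' :: e)) (hp : G.Adj p p')
    (hq : G.Adj q q') (hlen : 5 ≤ (p :: a ++ q :: b ++ p' :: c ++ q' :: e).length) :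
    IsGraphMinor (completeBipartiteGraph (Fin 2) (Fin 3)) G := by
  -- With `e` nonempty, `q'` reaches `p` along `e`, via the chord to `q` and back along `a`, and
  -- back along `c` to `p'` and its chord. Length five makes some arc nonempty, and rotation moves
  -- it to the place of `e`.
  have key : ∀ {p q p' q' : V} {a b c e : List V},
      IsCycleList G (p :: a ++ q :: b ++ p' :: c ++ q' :: e) → G.Adj p p' → G.Adj q q' → e ≠ [] →
      IsGraphMinor (completeBipartiteGraph (Fin 2) (Fin 3)) G := by
    intro p q p' q' a b c e h hp hq he
    have ch : (p :: a ++ q :: b ++ p' :: c ++ q' :: e ++ [p]).IsChain G.Adj := by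
      have := IsCycleList.isChain (a := p) (l := a ++ q :: b ++ p' :: c ++ q' :: e) (by simpa using h)
      simpa using this
    refine isGraphMinor_of_three_paths (x := q') (y := p) (a := e) (b := q :: a.reverse)
      (c := (p' :: c).reverse) he (by simp) (by simp) ?_ ?_ ?_ ?_
    · exact List.IsChain.right_of_append (l₁ := p :: a ++ q :: b ++ p' :: c) (by simpa using ch)
    · have : (p :: a ++ [q]).IsChain G.Adj :=
        List.IsChain.left_of_append (l₂ := b ++ p' :: c ++ q' :: e ++ [p]) (by simpa using ch)
      have : ((p :: a ++ [q]).reverse).IsChain G.Adj :=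
        List.isChain_reverse.mpr (this.imp fun _ _ h => h.symm)
      have : (q :: a.reverse ++ [p]).IsChain G.Adj := by simpa using this
      simpa [hq.symm] using this
    · have : (p' :: c ++ [q']).IsChain G.Adj :=
        List.IsChain.left_of_append (l₂ := e ++ [p]) (List.IsChain.right_of_append
          (l₁ := p :: a ++ q :: b) (by simpa using ch))
      have : (p :: (p' :: c ++ [q'])).IsChain G.Adj := by simpa [hp] using this
      have : ((p :: (p' :: c ++ [q'])).reverse).IsChain G.Adj :=
        List.isChain_reverse.mpr (this.imp fun _ _ h => h.symm)
      simpa using this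
    · have hs : List.Subperm (q' :: p :: (e ++ q :: a.reverse ++ (p' :: c).reverse))
          (p :: a ++ q :: b ++ p' :: c ++ q' :: e) := by
        classical
        rw [List.subperm_iff_count]
        intro z
        simp [List.count_cons]
        omega
      obtain ⟨l, hl, hl'⟩ := hs
      exact hl.nodup_iff.mp (h.nodup.sublist hl')
  have rot : ∀ {p q p' q' : V} {a b c e : List V},
      IsCycleList G (p :: a ++ q :: b ++ p' :: c ++ q' :: e) →
      IsCycleList G (q :: b ++ p' :: c ++ q' :: e ++ p :: a) := by
    intro p q p' q' a b c e h
    exact IsCycleList.rotate (l := p :: a) (by simpa using h)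
  by_cases he : e = []
  · by_cases ha : a = []
    · by_cases hb : b = []
      · have hc : c ≠ [] := by
          rintro rfl
          simp [he, ha, hb] at hlen
        exact key (rot (rot (rot h))) hq.symm hp hc
      · exact key (rot (rot h)) hp.symm hq.symm hb
    · exact key (rot h) hq hp.symm ha
  · exact key h hp hq he

/-- A walk in the cycle joining the two sides of `{b, e}` and avoiding `b, e` uses a chord. -/
theorem exists_chord_of_walkJoined {G : SimpleGraph V} {b e a c : V} {l l' : List V} {B : Set V}
    (hnd : (b :: l ++ e :: l').Nodup) (ha : a ∈ l') (hc : c ∈ l) (hB : ∀ z ∈ B, z ∈ b :: l ++ e :: l')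
    (hb : b ∉ B) (he : e ∉ B) (h : WalkJoined G B a c) :
    ∃ p ∈ B, ∃ q ∈ B, G.Adj p q ∧ p ∈ l' ∧ q ∈ l := by
  have hcl : c ∉ l' := by
    simp only [List.cons_append, List.nodup_cons, List.nodup_append, List.mem_cons] at hnd
    intro h'
    exact hnd.2.2.2 c hc c (Or.inr h') rfl
  obtain ⟨p, hp, q, hq, h1, h2, h3⟩ := h.exists_boundary {z | z ∈ l'} ha hcl
  refine ⟨p, hp, q, hq, h3, h1, ?_⟩
  have := hB q hq
  simp only [List.cons_append, List.mem_cons, List.mem_append] at this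
  rcases this with rfl | h | rfl | h
  · exact absurd hq hb
  · exact h
  · exact absurd hq he
  · exact absurd h h2

/-- The metric betweenness set. -/
def segment (d : Matrix V V ℝ) (u v : V) : Set V := {z | d u z + d z v = d u v}

/-- Within `A`, any two points are joined by a walk along a geodesic. -/
def GeodesicOn (G : SimpleGraph V) (d : Matrix V V ℝ) (A : Set V) : Prop :=
  ∀ u ∈ A, ∀ v ∈ A, WalkJoined G (A ∩ segment d u v) u v

theorem exists_mem_crossing_walks {G : SimpleGraph V} {b e a c : V} {l l' : List V} {B B' : Set V}
    (hK : ¬ IsGraphMinor (completeBipartiteGraph (Fin 2) (Fin 3)) G)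
    (h : IsCycleList G (b :: l ++ e :: l')) (ha : a ∈ l') (hc : c ∈ l)
    (hlen : 5 ≤ (b :: l ++ e :: l').length)
    (hB : ∀ z ∈ B, z ∈ b :: l ++ e :: l') (hB' : ∀ z ∈ B', z ∈ b :: l ++ e :: l')
    (hac : WalkJoined G B a c) (hbe : WalkJoined G B' b e) : ∃ z ∈ B, z ∈ B' := by
  by_contra! hdis
  have hb : b ∉ B := fun hb => hdis b hb hbe.mem_left
  have he : e ∉ B := fun he => hdis e he hbe.mem_right
  obtain ⟨p, hp, q, hq, hpq, hpl, hql⟩ := exists_chord_of_walkJoined h.nodup ha hc hB hb he hac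
  obtain ⟨l₁, l₂, rfl⟩ := List.append_of_mem hql
  obtain ⟨l₁', l₂', rfl⟩ := List.append_of_mem hpl
  -- Recut the cycle at the ends of the first chord. The second walk avoids them and has its ends on
  -- different arcs, so it uses a chord crossing the first.
  have h' : IsCycleList G (q :: (l₂ ++ e :: l₁') ++ p :: (l₂' ++ b :: l₁)) := by
    have := IsCycleList.rotate (l := b :: l₁) (l' := q :: l₂ ++ e :: l₁' ++ p :: l₂')
      (by simpa using h)
    simpa using this
  have hlen' : 5 ≤ (q :: (l₂ ++ e :: l₁') ++ p :: (l₂' ++ b :: l₁)).length := by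
    simp at hlen ⊢
    omega
  obtain ⟨p', hp', q', hq', hpq', hpl', hql'⟩ := exists_chord_of_walkJoined (a := b) (c := e)
    h'.nodup (by simp) (by simp) (B := B') (fun z hz => by have := hB' z hz; simp at this ⊢; tauto)
    (hdis q hq) (hdis p hp) hbe
  obtain ⟨m₁, m₂, hm⟩ := List.append_of_mem hql'
  obtain ⟨m₁', m₂', hm'⟩ := List.append_of_mem hpl'
  rw [hm, hm'] at h' hlen'
  exact hK (isGraphMinor_of_crossing_chords (p := q) (q := q') (p' := p) (q' := p') (a := m₁)
    (b := m₂) (c := m₁') (e := m₂') (by simpa using h') hpq.symm hpq'.symm (by simpa using hlen'))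

/-- A Hamiltonian cycle of a `K_{2,3}`-minor-free graph on at least five vertices is a Kalmanson
order. -/
theorem IsCycleList.isKalmanson [DecidableEq V] {G : SimpleGraph V} {d : Matrix V V ℝ}
    (hd : IsSemimetric d) (hK : ¬ IsGraphMinor (completeBipartiteGraph (Fin 2) (Fin 3)) G)
    {l : List V} (h : IsCycleList G l) (hlen : 5 ≤ l.length) (hG : GeodesicOn G d {z | z ∈ l}) :
    IsKalmanson d l := by
  intro a b c e hs
  -- A common point `z` of the two diagonals' geodesics gives both inequalities by going through
  -- `z`.
  obtain ⟨z, hz, hz'⟩ : ∃ z ∈ segment d a c, z ∈ segment d b e := by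
    have mem : ∀ z ∈ [a, b, c, e], z ∈ l := fun z hz => hs.subset hz
    have hac := hG a (mem a (by simp)) c (mem c (by simp))
    have hbe := hG b (mem b (by simp)) e (mem e (by simp))
    obtain ⟨r₁, s₁, rfl, h1, hs₁⟩ := List.cons_sublist_iff.mp hs
    obtain ⟨r₂, s₂, rfl, h2, hs₂⟩ := List.cons_sublist_iff.mp hs₁
    obtain ⟨r₃, s₃, rfl, h3, hs₃⟩ := List.cons_sublist_iff.mp hs₂
    rw [List.singleton_sublist] at hs₃
    obtain ⟨t₂, t₂', rfl⟩ := List.append_of_mem h2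
    obtain ⟨t₃, t₃', rfl⟩ := List.append_of_mem hs₃
    have h' : IsCycleList G (b :: (t₂' ++ r₃ ++ t₃) ++ e :: (t₃' ++ r₁ ++ t₂)) := by
      have := IsCycleList.rotate (l := r₁ ++ t₂) (l' := b :: (t₂' ++ r₃ ++ t₃) ++ e :: t₃')
        (by simpa using h)
      simpa using this
    obtain ⟨z, hz, hz'⟩ := exists_mem_crossing_walks hK h' (by simp [h1]) (by simp [h3])
      (by simp at hlen ⊢; omega) (fun z hz => by have := hz.1; simp at this ⊢; tauto)
      (fun z hz => by have := hz.1; simp at this ⊢; tauto) hac hbe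
    exact ⟨z, hz.2, hz'.2⟩
  change d a z + d z c = d a c at hz
  change d b z + d z e = d b e at hz'
  have := hd.triangle a z b
  have := hd.triangle c z e
  have := hd.triangle a z e
  have := hd.triangle b z c
  have := hd.symm b z
  have := hd.symm c z
  constructor <;> linarith

/-- Two different pairings on the `f` side force four distinct images, so at most one is `v`. Then
three of the `g` images equal `v`, which no 2+2 separation allows. -/
theorem not_separatesPairs_of_cutpoint {f g : V → V} {v a b c e : V} {S S' T : Finset V}
    (hz : ∀ z ∈ [a, b, c, e], f z = v ∨ g z = v) (h : SeparatesPairs S (f a) (f b) (f c) (f e))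
    (h' : SeparatesPairs S' (f a) (f c) (f b) (f e)) :
    ¬ SeparatesPairs T (g a) (g e) (g b) (g c) := by
  intro h''
  have ne : ∀ {S : Finset V} {p q r t : V}, SeparatesPairs S p q r t →
      p ≠ r ∧ p ≠ t ∧ q ≠ r ∧ q ≠ t := by
    rintro S p q r t ⟨h1, h2, h3⟩
    refine ⟨?_, ?_, ?_, ?_⟩ <;> rintro rfl <;> tauto
  have n1 := ne h
  have n2 := ne h'
  have n3 := ne h''
  have ha := hz a (by simp)
  have hb := hz b (by simp)
  have hc := hz c (by simp)
  have he := hz e (by simp)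
  clear ne h h' h'' hz
  grind

theorem WeaklyCompatibleOn.sum_glue [DecidableEq V] {ι κ : Type*} {A A₁ A₂ : Finset V} {f g : V → V} {v : V}
    {s : ι → Finset V} {t : κ → Finset V} (hs : WeaklyCompatibleOn A₁ s)
    (ht : WeaklyCompatibleOn A₂ t) (hf : ∀ z ∈ A, f z ∈ A₁) (hg : ∀ z ∈ A, g z ∈ A₂)
    (hfg : ∀ z ∈ A, f z = v ∨ g z = v) :
    WeaklyCompatibleOn A (Sum.elim (fun k => A.filter fun z => f z ∈ s k)
      (fun k => A.filter fun z => g z ∈ t k)) := by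
  intro a ha b hb c hc e he i j k h1 h2 h3
  have conv : ∀ (F : V → V) (S : Finset V) {a b c e : V}, a ∈ A → b ∈ A → c ∈ A → e ∈ A →
      SeparatesPairs (A.filter fun z => F z ∈ S) a b c e →
      SeparatesPairs S (F a) (F b) (F c) (F e) := by
    intro F S a b c e ha hb hc he h
    simpa [SeparatesPairs, ha, hb, hc, he] using h
  have sw : ∀ {S : Finset V} {a b c e : V}, SeparatesPairs S a b c e → SeparatesPairs S a b e c :=
    fun h => h.symm.swap_left.symm
  have hz : ∀ a ∈ A, ∀ b ∈ A, ∀ c ∈ A, ∀ e ∈ A, ∀ z ∈ [a, b, c, e], f z = v ∨ g z = v := by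
    intro a ha b hb c hc e he z hz
    apply hfg
    simp only [List.mem_cons, List.not_mem_nil, or_false] at hz
    rcases hz with rfl | rfl | rfl | rfl <;> assumption
  have hz' := fun a ha b hb c hc e he z h => (hz a ha b hb c hc e he z h).symm
  rcases i with i | i <;> rcases j with j | j <;> rcases k with k | k <;>
    replace h1 := conv _ _ ha hb hc he h1 <;> replace h2 := conv _ _ ha hc hb he h2 <;>
    replace h3 := conv _ _ ha he hb hc h3
  · exact hs _ (hf _ ha) _ (hf _ hb) _ (hf _ hc) _ (hf _ he) i j k h1 h2 h3
  · exact not_separatesPairs_of_cutpoint (hz a ha b hb c hc e he) h1 h2 h3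
  · exact not_separatesPairs_of_cutpoint (hz a ha b hb e he c hc) (sw h1) h3 h2
  · exact not_separatesPairs_of_cutpoint (hz' a ha c hc e he b hb) (sw h2) (sw h3) h1
  · exact not_separatesPairs_of_cutpoint (hz a ha c hc e he b hb) (sw h2) (sw h3) h1
  · exact not_separatesPairs_of_cutpoint (hz' a ha b hb e he c hc) (sw h1) h3 h2
  · exact not_separatesPairs_of_cutpoint (hz' a ha b hb c hc e he) h1 h2 h3
  · exact ht _ (hg _ ha) _ (hg _ hb) _ (hg _ hc) _ (hg _ he) i j k h1 h2 h3

/-- Weak decomposability is preserved by gluing at a point. -/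
theorem WeaklyDecomposableOn.glue [DecidableEq V] {d : Matrix V V ℝ} (hd : IsSemimetric d)
    {A₁ A₂ : Finset V} {v : V} (h₁ : WeaklyDecomposableOn A₁ d) (h₂ : WeaklyDecomposableOn A₂ d)
    (hv₁ : v ∈ A₁) (hv₂ : v ∈ A₂) (hA : ∀ z ∈ A₁, z ∈ A₂ → z = v)
    (hadd : ∀ u ∈ A₁, ∀ w ∈ A₂, d u w = d u v + d v w) : WeaklyDecomposableOn (A₁ ∪ A₂) d := by
  obtain ⟨ι, _, s, w, hw, hs, hc⟩ := h₁
  obtain ⟨κ, _, t, x, hx, ht, hc'⟩ := h₂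
  -- `f` and `g` retract the two pieces, sending the opposite piece to `v`; the distance is the sum
  -- of those of the images.
  let f : V → V := fun z => if z ∈ A₁ then z else v
  let g : V → V := fun z => if z ∈ A₂ then z else v
  have hf : ∀ z, f z ∈ A₁ := fun z => by simp only [f]; split_ifs <;> assumption
  have hg : ∀ z, g z ∈ A₂ := fun z => by simp only [g]; split_ifs <;> assumption
  have hfg : ∀ z ∈ A₁ ∪ A₂, f z = v ∨ g z = v := by
    intro z hz
    simp only [f, g]
    have := hA z
    split_ifs <;> simp_all
  refine ⟨ι ⊕ κ, inferInstance, _, Sum.elim w x, ?_, ?_,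
    hc.sum_glue hc' (fun z _ => hf z) (fun z _ => hg z) hfg⟩
  · rintro (k | k)
    · exact hw k
    · exact hx k
  · intro u hu z hz
    have e : d u z = d (f u) (f z) + d (g u) (g z) := by
      rw [Finset.mem_union] at hu hz
      have fv : f v = v := by simp [f]
      have gv : g v = v := by simp [g]
      have f1 : ∀ z ∈ A₁, f z = z ∧ g z = v := fun z hz => by
        refine ⟨by simp [f, hz], ?_⟩
        simp only [g]
        split_ifs with h
        · exact hA z hz h
        · rfl
      have g1 : ∀ z ∈ A₂, f z = v ∧ g z = z := fun z hz => by
        refine ⟨?_, by simp [g, hz]⟩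
        simp only [f]
        split_ifs with h
        · exact hA z h hz
        · rfl
      rcases hu with hu | hu <;> rcases hz with hz | hz
      · rw [(f1 u hu).1, (f1 u hu).2, (f1 z hz).1, (f1 z hz).2, hd.self, add_zero]
      · rw [(f1 u hu).1, (f1 u hu).2, (g1 z hz).1, (g1 z hz).2, hadd u hu z hz]
      · rw [(g1 u hu).1, (g1 u hu).2, (f1 z hz).1, (f1 z hz).2, hd.symm u z, hadd z hz u hu,
          hd.symm z v, hd.symm v u]
      · rw [(g1 u hu).1, (g1 u hu).2, (g1 z hz).1, (g1 z hz).2, hd.self, zero_add]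
    rw [e, hs _ (hf u) _ (hf z), ht _ (hg u) _ (hg z), Fintype.sum_sum_type]
    congr 1 <;> refine Finset.sum_congr rfl fun k _ => ?_ <;>
      simp only [Sum.elim_inl, Sum.elim_inr, cutMetric, Matrix.of_apply, Finset.mem_filter, hu, hz,
        true_and]

end

/-! ### The induction: cut vertices and longest cycles -/

section
variable {V : Type*}

theorem GeodesicOn.of_cutpoint {G : SimpleGraph V} {d : Matrix V V ℝ} {A A₁ : Set V} {v : V}
    (h : GeodesicOn G d A) (hA₁ : A₁ ⊆ A) (hv : v ∈ A₁)
    (hcut : ∀ x ∈ A₁, ∀ y ∈ A \ A₁, G.Adj x y → x = v) : GeodesicOn G d A₁ := by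
  classical
  intro u hu w hw
  have huw := h u (hA₁ hu) w (hA₁ hw)
  by_cases hin : A ∩ segment d u w ⊆ A₁
  · exact huw.mono fun z hz => ⟨hin hz, hz.2⟩
  -- If `v` is on the segment, the outside part of the walk is collapsed to `v`. If not, the walk
  -- cannot leave `A₁`, as its exit would be through `v`.
  by_cases hvs : v ∈ segment d u w
  · let f : V → V := fun z => if z ∈ A₁ then z else v
    have e : ∀ z ∈ A₁, f z = z := fun z hz => if_pos hz
    have e' : ∀ z ∉ A₁, f z = v := fun z hz => if_neg hz
    rw [← e u hu, ← e w hw]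
    refine WalkJoined.map (B := A ∩ segment d u w) f ?_ ?_ huw
    · intro x hx y hy hxy
      by_cases hx' : x ∈ A₁ <;> by_cases hy' : y ∈ A₁
      · rw [e x hx', e y hy']; exact Or.inr hxy
      · rw [e x hx', e' y hy']; exact Or.inl (hcut x hx' y ⟨hy.1, hy'⟩ hxy)
      · rw [e' x hx', e y hy']; exact Or.inl (hcut y hy' x ⟨hx.1, hx'⟩ hxy.symm).symm
      · rw [e' x hx', e' y hy']; exact Or.inl rfl
    · intro x hx
      rw [e u hu, e w hw]
      by_cases hx' : x ∈ A₁
      · rw [e x hx']; exact ⟨hx', hx.2⟩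
      · rw [e' x hx']; exact ⟨hv, hvs⟩
  · obtain ⟨p, hp⟩ := huw
    refine ⟨p, fun z hz => ⟨?_, (hp z hz).2⟩⟩
    by_contra hz'
    obtain ⟨x, hx, y, hy, hx1, hy1, hxy⟩ := WalkJoined.exists_boundary (B := A ∩ segment d u w)
      ⟨p.takeUntil z hz, fun y hy => hp y (p.support_takeUntil_subset_support hz hy)⟩ A₁ hu hz'
    exact hvs (hcut x hx1 y ⟨hy.1, hy1⟩ hxy ▸ hx.2)

theorem exists_maximal_cycleList [DecidableEq V] {G : SimpleGraph V} (A : Finset V) {a b : V} (ha : a ∈ A)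
    (hb : b ∈ A) (hab : G.Adj a b) : ∃ l, IsCycleList G l ∧ (∀ z ∈ l, z ∈ A) ∧ 2 ≤ l.length ∧
      ∀ m, IsCycleList G m → (∀ z ∈ m, z ∈ A) → m.length ≤ l.length := by
  let S : Set ℕ := {n | ∃ l, IsCycleList G l ∧ (∀ z ∈ l, z ∈ A) ∧ l.length = n}
  have h2 : 2 ∈ S := ⟨[a, b], .of_edge hab, by simp [ha, hb], rfl⟩
  have hbdd : BddAbove S := by
    refine ⟨A.card, ?_⟩
    rintro n ⟨l, hl, hlA, rfl⟩
    rw [← List.toFinset_card_of_nodup hl.nodup]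
    exact Finset.card_le_card fun z hz => hlA z (List.mem_toFinset.mp hz)
  obtain ⟨l, hl, hlA, hlen⟩ := Nat.sSup_mem ⟨2, h2⟩ hbdd
  refine ⟨l, hl, hlA, hlen ▸ le_csSup hbdd h2, fun m hm hmA => ?_⟩
  exact hlen ▸ le_csSup hbdd ⟨m, hm, hmA, rfl⟩

/-- A `K_{2,3}`-minor-free graph only carries weakly decomposable metrics. -/
theorem weaklyDecomposableOn_of_geodesicOn [DecidableEq V] {G : SimpleGraph V} {d : Matrix V V ℝ}
    (hd : IsSemimetric d) (hK : ¬ IsGraphMinor (completeBipartiteGraph (Fin 2) (Fin 3)) G)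
    (A : Finset V) (hG : GeodesicOn G d A) : WeaklyDecomposableOn A d := by
  classical
  induction A using Finset.strongInduction with
  | H A ih =>
  by_cases hcard : A.card ≤ 4
  · obtain ⟨l, hl, rfl, hl'⟩ := exists_isKalmanson_of_card_le_four hd A hcard
    exact hl'.weaklyDecomposableOn hd hl
  obtain ⟨a, ha, b, hb, hab⟩ : ∃ a ∈ A, ∃ b ∈ A, G.Adj a b := by
    obtain ⟨u, hu, v, hv, huv⟩ := Finset.one_lt_card.mp (show 1 < A.card by omega)
    obtain ⟨x, hx, y, hy, _, _, hxy⟩ := (hG u hu v hv).exists_boundary {u} rfl fun h => huv h.symm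
    exact ⟨x, hx.1, y, hy.1, hxy⟩
  obtain ⟨l, hl, hlA, hl2, hmax⟩ := exists_maximal_cycleList A ha hb hab
  by_cases hham : ∀ z ∈ A, z ∈ l
  · have e : l.toFinset = A := by
      ext z
      rw [List.mem_toFinset]
      exact ⟨hlA z, hham z⟩
    have e' : {z | z ∈ l} = (A : Set V) := by
      ext z
      exact ⟨hlA z, hham z⟩
    have hlen : l.length = A.card := by rw [← e, List.toFinset_card_of_nodup hl.nodup]
    rw [← e]
    exact (hl.isKalmanson hd hK (by omega) (e' ▸ hG)).weaklyDecomposableOn hd hl.nodup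
  push Not at hham
  obtain ⟨w₀, hw₀, hw₀l⟩ := hham
  -- The component of `w₀` in `A` minus the cycle.
  let K : Set V := {z | WalkJoined G {z | z ∈ A ∧ z ∉ l} w₀ z}
  have hKA : ∀ z ∈ K, z ∈ A ∧ z ∉ l := fun z hz => hz.mem_right
  have hw₀K : w₀ ∈ K := .refl ⟨hw₀, hw₀l⟩
  have hnbr : ∀ x ∈ K, ∀ y ∈ A, y ∉ K → G.Adj x y → y ∈ l := by
    intro x hx y hy hyK hxy
    by_contra hyl
    exact hyK (hx.trans (.of_adj hxy (hKA x hx) ⟨hy, hyl⟩))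
  -- Two attachment vertices would be joined by a path through `K`, which lengthens the cycle or
  -- creates the minor.
  have huniq : ∀ x ∈ l, ∀ y ∈ l, ∀ kx ∈ K, ∀ ky ∈ K, G.Adj x kx → G.Adj ky y → x = y := by
    intro x hx y hy kx hkx ky hky hxk hky'
    by_contra hne
    obtain ⟨k, hk0, hk, hkK, hkc⟩ := (hkx.component.symm.trans hky.component).exists_chain hxk hky'
    obtain ⟨l₁, l₂, rfl⟩ := List.append_of_mem hx
    have hl' : IsCycleList G (x :: l₂ ++ l₁) := hl.rotate
    have hy' : y ∈ l₂ ++ l₁ := by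
      simp only [List.mem_append, List.mem_cons] at hy ⊢
      rcases hy with hy | rfl | hy
      · exact Or.inr hy
      · exact absurd rfl hne
      · exact Or.inl hy
    obtain ⟨m₁, m₂, hm⟩ := List.append_of_mem hy'
    have hmem : ∀ z, z ∈ x :: m₁ ++ y :: m₂ → z ∈ l₁ ++ x :: l₂ := by
      intro z hz
      rw [List.cons_append, ← hm] at hz
      simp at hz ⊢
      tauto
    have hlen : (x :: m₁ ++ y :: m₂).length = (l₁ ++ x :: l₂).length := by
      rw [List.cons_append, ← hm]
      simp
      omega
    rw [List.cons_append, hm] at hl'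
    rcases IsCycleList.longer_or_minor (x := x) (y := y) (l := m₁) (l' := m₂) (by simpa using hl')
      hk0 hk hkc fun z hz hz' => (hKA z (hkK z hz')).2 (hmem z hz) with ⟨m, hm, hml, hmA⟩ | h
    · have := hmax m hm fun z hz => (hmA z hz).elim (fun h => hlA z (hmem z h))
        fun h => (hKA z (hkK z h)).1
      have := List.length_pos_iff.mpr hk0
      omega
    · exact hK h
  obtain ⟨v, hv, hvK⟩ : ∃ v ∈ l, ∀ y ∈ l, ∀ x ∈ K, G.Adj x y → y = v := by
    by_cases h : ∃ v ∈ l, ∃ x ∈ K, G.Adj x v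
    · obtain ⟨v, hv, x, hx, hxv⟩ := h
      exact ⟨v, hv, fun y hy x' hx' h => huniq y hy v hv x' hx' x hx h.symm hxv⟩
    -- Without any attachment, an arbitrary cycle vertex serves as `v`.
    · push Not at h
      obtain ⟨v, hv⟩ := List.exists_mem_of_ne_nil l hl.ne_nil
      exact ⟨v, hv, fun y hy x hx hxy => absurd hxy (h y hy x hx)⟩
  have hvK' : v ∉ K := fun h => (hKA v h).2 hv
  have hcross : ∀ x ∈ K, ∀ y ∈ A, y ∉ K → G.Adj x y → y = v := fun x hx y hy hyK hxy =>
    hvK y (hnbr x hx y hy hyK hxy) x hx hxy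
  let A₁ := A.filter fun z => z ∈ K ∨ z = v
  let A₂ := A.filter fun z => z ∉ K
  have m₁ : ∀ z, z ∈ A₁ ↔ z ∈ A ∧ (z ∈ K ∨ z = v) := fun z => Finset.mem_filter
  have m₂ : ∀ z, z ∈ A₂ ↔ z ∈ A ∧ z ∉ K := fun z => Finset.mem_filter
  have hU : A = A₁ ∪ A₂ := by
    ext z
    rw [Finset.mem_union, m₁, m₂]
    tauto
  have hvA := hlA v hv
  have s₁ : A₁ ⊂ A := by
    refine Finset.ssubset_iff_subset_ne.mpr ⟨Finset.filter_subset _ _, fun h => ?_⟩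
    -- The cycle is disjoint from `K`, so this would leave it only `v`, while it has at least two
    -- vertices.
    have : l.toFinset ⊆ {v} := by
      intro z hz
      rw [List.mem_toFinset] at hz
      have := hlA z hz
      rw [← h, m₁] at this
      rcases this.2 with h | rfl
      · exact absurd hz (hKA z h).2
      · simp
    have := Finset.card_le_card this
    rw [List.toFinset_card_of_nodup hl.nodup, Finset.card_singleton] at this
    omega
  have s₂ : A₂ ⊂ A := by
    refine Finset.ssubset_iff_subset_ne.mpr ⟨Finset.filter_subset _ _, fun h => ?_⟩
    have := hw₀
    rw [← h, m₂] at this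
    exact this.2 hw₀K
  have g₁ : GeodesicOn G d A₁ := by
    refine hG.of_cutpoint (v := v) (by exact_mod_cast s₁.1) ((m₁ v).mpr ⟨hvA, Or.inr rfl⟩) ?_
    rintro x hx y ⟨hy, hy'⟩ hxy
    rw [Finset.mem_coe, m₁] at hx hy'
    rw [Finset.mem_coe] at hy
    rcases hx.2 with hxK | rfl
    · have := hcross x hxK y hy (fun h => hy' ⟨hy, Or.inl h⟩) hxy
      exact absurd ⟨hy, Or.inr this⟩ hy'
    · rfl
  have g₂ : GeodesicOn G d A₂ := by
    refine hG.of_cutpoint (v := v) (by exact_mod_cast s₂.1) ((m₂ v).mpr ⟨hvA, hvK'⟩) ?_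
    rintro x hx y ⟨hy, hy'⟩ hxy
    rw [Finset.mem_coe, m₂] at hx hy'
    rw [Finset.mem_coe] at hy
    exact hcross y (by tauto) x hx.1 hx.2 hxy.symm
  have hadd : ∀ u ∈ A₁, ∀ w ∈ A₂, d u w = d u v + d v w := by
    intro u hu w hw
    rw [m₁] at hu
    rw [m₂] at hw
    rcases hu.2 with huK | rfl
    · obtain ⟨x, hx, y, hy, hxK, hyK, hxy⟩ := (hG u hu.1 w hw.1).exists_boundary K huK hw.2
      have := hcross x hxK y hy.1 hyK hxy
      subst this
      exact hy.2.symm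
    · rw [hd.self, zero_add]
  rw [hU]
  refine (ih A₁ s₁ g₁).glue hd (ih A₂ s₂ g₂) ((m₁ v).mpr ⟨hvA, Or.inr rfl⟩)
    ((m₂ v).mpr ⟨hvA, hvK'⟩) (fun z h1 h2 => ?_) hadd
  rw [m₁] at h1
  rw [m₂] at h2
  tauto

end

/-! ### Distance matrices of weighted graphs -/

section
variable {V : Type*} {G : SimpleGraph V} {φ : G.edgeSet → ℝ≥0}

theorem walkLength_nonneg {u v : V} (p : G.Walk u v) : 0 ≤ walkLength φ p := by
  induction p with
  | nil => exact le_rfl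
  | cons h p ih => exact add_nonneg (NNReal.coe_nonneg _) ih

theorem walkLength_append {u v w : V} (p : G.Walk u v) (q : G.Walk v w) :
    walkLength φ (p.append q) = walkLength φ p + walkLength φ q := by
  induction p with
  | nil => simp [walkLength]
  | cons h p ih => simp only [SimpleGraph.Walk.cons_append, walkLength, ih, add_assoc]

theorem walkLength_reverse {u v : V} (p : G.Walk u v) :
    walkLength φ p.reverse = walkLength φ p := by
  induction p with
  | nil => rfl
  | @cons a b c h p ih =>
    simp only [SimpleGraph.Walk.reverse_cons, walkLength_append, walkLength, ih, add_zero]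
    rw [add_comm]
    congr 3
    exact Subtype.ext Sym2.eq_swap

theorem walkLength_bypass_le [DecidableEq V] {u v : V} (p : G.Walk u v) :
    walkLength φ p.bypass ≤ walkLength φ p := by
  induction p with
  | nil => exact le_rfl
  | cons h p ih =>
    simp only [SimpleGraph.Walk.bypass]
    split_ifs with hs
    · have e := walkLength_append (φ := φ) (p.bypass.takeUntil _ hs) (p.bypass.dropUntil _ hs)
      rw [SimpleGraph.Walk.take_spec] at e
      have := walkLength_nonneg (φ := φ) (p.bypass.takeUntil _ hs)
      have : (0 : ℝ) ≤ φ ⟨s(_, _), G.mem_edgeSet.mpr h⟩ := NNReal.coe_nonneg _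
      simp only [walkLength]
      linarith
    · simp only [walkLength]
      linarith

theorem distanceMatrix_nonneg (u v : V) : 0 ≤ distanceMatrix G φ u v :=
  Real.iInf_nonneg fun _ => walkLength_nonneg _

theorem distanceMatrix_le_walkLength {u v : V} (p : G.Walk u v) :
    distanceMatrix G φ u v ≤ walkLength φ p := by
  classical
  refine le_trans ?_ (walkLength_bypass_le p)
  have hb : BddBelow (Set.range fun p : G.Path u v => walkLength φ (p : G.Walk u v)) :=
    ⟨0, by rintro _ ⟨p, rfl⟩; exact walkLength_nonneg _⟩
  exact ciInf_le hb p.toPath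

theorem distanceMatrix_le_weight {u v : V} (h : G.Adj u v) :
    distanceMatrix G φ u v ≤ φ ⟨s(u, v), G.mem_edgeSet.mpr h⟩ := by
  simpa [walkLength] using distanceMatrix_le_walkLength (φ := φ) h.toWalk

theorem isSemimetric_distanceMatrix [Fintype V] [DecidableEq V] (hG : G.Connected) :
    IsSemimetric (distanceMatrix G φ) := by
  have symm : ∀ u v, distanceMatrix G φ u v ≤ distanceMatrix G φ v u := by
    intro u v
    obtain ⟨p, hp⟩ := exists_path_length_eq G hG φ v u
    rw [← hp, ← walkLength_reverse]
    exact distanceMatrix_le_walkLength _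
  refine ⟨fun u => le_antisymm ?_ (distanceMatrix_nonneg _ _),
    fun u v => le_antisymm (symm u v) (symm v u), fun u v x => ?_⟩
  · exact distanceMatrix_le_walkLength (φ := φ) (.nil : G.Walk u u)
  · obtain ⟨p, hp⟩ := exists_path_length_eq G hG φ u v
    obtain ⟨q, hq⟩ := exists_path_length_eq G hG φ v x
    rw [← hp, ← hq, ← walkLength_append]
    exact distanceMatrix_le_walkLength _

theorem geodesicOn_distanceMatrix [Fintype V] [DecidableEq V] (hG : G.Connected) :
    GeodesicOn G (distanceMatrix G φ) Set.univ := by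
  intro u _ v _
  obtain ⟨p, hp⟩ := exists_path_length_eq G hG φ u v
  refine ⟨p, fun z hz => ⟨trivial, le_antisymm ?_ ((isSemimetric_distanceMatrix hG).triangle u z v)⟩⟩
  have e := walkLength_append (φ := φ) ((p : G.Walk u v).takeUntil z hz) ((p : G.Walk u v).dropUntil z hz)
  rw [SimpleGraph.Walk.take_spec, hp] at e
  rw [e]
  exact add_le_add (distanceMatrix_le_walkLength _) (distanceMatrix_le_walkLength _)

theorem IsSemimetric.nonneg {d : Matrix V V ℝ} (hd : IsSemimetric d) (u v : V) : 0 ≤ d u v := by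
  have := hd.triangle u v u
  rw [hd.self, hd.symm v u] at this
  linarith

/-- The distance matrix is the largest semimetric bounded by the weights on edges; this supplies the
lower bounds on distances. -/
theorem IsSemimetric.le_distanceMatrix {d : Matrix V V ℝ} (hd : IsSemimetric d) (hG : G.Connected)
    (h : ∀ u v (huv : G.Adj u v), d u v ≤ φ ⟨s(u, v), G.mem_edgeSet.mpr huv⟩) (u v : V) :
    d u v ≤ distanceMatrix G φ u v := by
  classical
  have : Nonempty (G.Path u v) := ⟨(hG.preconnected u v).some.toPath⟩
  have main : ∀ {u v : V} (p : G.Walk u v), d u v ≤ walkLength φ p := by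
    intro u v p
    induction p with
    | nil => exact (hd.self _).le
    | cons huv p ih => exact (hd.triangle _ _ _).trans (add_le_add (h _ _ huv) ih)
  exact le_ciInf fun p => main _

theorem IsSemimetric.exists_weight {d : Matrix V V ℝ} (hd : IsSemimetric d) (G : SimpleGraph V) :
    ∃ φ : G.edgeSet → ℝ≥0, ∀ u v (huv : G.Adj u v),
      (φ ⟨s(u, v), G.mem_edgeSet.mpr huv⟩ : ℝ) = d u v := by
  refine ⟨fun e => Sym2.lift ⟨fun u v => (d u v).toNNReal, fun u v => ?_⟩ e.1, fun u v _ => ?_⟩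
  · exact congrArg Real.toNNReal (hd.symm u v)
  · simp [hd.nonneg]

theorem IsSemimetric.comap {W : Type*} {d : Matrix W W ℝ} (hd : IsSemimetric d) (f : V → W) :
    IsSemimetric (d.submatrix f f) :=
  ⟨fun _ => hd.self _, fun _ _ => hd.symm _ _, fun _ _ _ => hd.triangle _ _ _⟩

/-- The graph distance of the complete bipartite graph (with at least one vertex on each side). -/
def bipartiteDist (α β : Type*) [DecidableEq α] [DecidableEq β] : Matrix (α ⊕ β) (α ⊕ β) ℝ :=
  Matrix.of fun i j => if i = j then 0 else if i.isLeft = j.isLeft then 2 else 1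

theorem isSemimetric_bipartiteDist (α β : Type*) [DecidableEq α] [DecidableEq β] :
    IsSemimetric (bipartiteDist α β) := by
  refine ⟨fun u => by simp [bipartiteDist], fun u v => ?_, fun u v x => ?_⟩
  · simp [bipartiteDist, eq_comm]
  · simp only [bipartiteDist, Matrix.of_apply]
    split_ifs <;> first | (exfalso; simp_all; done) | norm_num

theorem bipartiteDist_le_of_adj {α β : Type*} [DecidableEq α] [DecidableEq β] [Nonempty α]
    [Nonempty β] {d : Matrix (α ⊕ β) (α ⊕ β) ℝ} (hd : IsSemimetric d) {c : ℝ}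
    (h : ∀ i j, (completeBipartiteGraph α β).Adj i j → d i j ≤ c) (i j : α ⊕ β) :
    d i j ≤ c * bipartiteDist α β i j := by
  by_cases hij : i = j
  · subst hij
    simp [bipartiteDist, hd.self]
  obtain ⟨a⟩ := ‹Nonempty α›
  obtain ⟨b⟩ := ‹Nonempty β›
  rcases i with i | i <;> rcases j with j | j
  · have h1 := h (.inl i) (.inr b) (by simp)
    have h2 := h (.inr b) (.inl j) (by simp)
    have := hd.triangle (.inl i) (.inr b) (.inl j)
    simp only [bipartiteDist, Matrix.of_apply, hij, if_false, Sum.isLeft_inl, if_true]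
    linarith
  · simpa [bipartiteDist] using h (.inl i) (.inr j) (by simp)
  · simpa [bipartiteDist] using h (.inr i) (.inl j) (by simp)
  · have h1 := h (.inr i) (.inl a) (by simp)
    have h2 := h (.inl a) (.inr j) (by simp)
    have := hd.triangle (.inr i) (.inl a) (.inr j)
    simp only [bipartiteDist, Matrix.of_apply, hij, if_false, Sum.isLeft_inr, if_true]
    linarith

theorem connected_completeBipartiteGraph (α β : Type*) [Nonempty α] [Nonempty β] :
    (completeBipartiteGraph α β).Connected := by
  obtain ⟨a⟩ := ‹Nonempty α›
  obtain ⟨b⟩ := ‹Nonempty β›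
  have hab : (completeBipartiteGraph α β).Reachable (.inl a) (.inr b) :=
    SimpleGraph.Adj.reachable (by simp)
  rw [SimpleGraph.connected_iff_exists_forall_reachable]
  refine ⟨.inl a, ?_⟩
  rintro (i | i)
  · exact hab.trans (SimpleGraph.Adj.reachable (by simp))
  · exact SimpleGraph.Adj.reachable (by simp)

theorem distanceMatrix_completeBipartiteGraph {α β : Type*} [Fintype α] [Fintype β]
    [DecidableEq α] [DecidableEq β] [Nonempty α] [Nonempty β] (c : ℝ≥0) :
    distanceMatrix (completeBipartiteGraph α β) (fun _ => c) = (c : ℝ) • bipartiteDist α β := by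
  have hc := connected_completeBipartiteGraph α β
  have hb := isSemimetric_bipartiteDist α β
  have hcb : IsSemimetric ((c : ℝ) • bipartiteDist α β) := by
    refine ⟨fun u => ?_, fun u v => ?_, fun u v x => ?_⟩
    · simp [hb.self]
    · simp [hb.symm u v]
    · simp only [Matrix.smul_apply, smul_eq_mul, ← mul_add]
      exact mul_le_mul_of_nonneg_left (hb.triangle u v x) c.2
  ext i j
  refine le_antisymm ?_ (hcb.le_distanceMatrix hc (fun u v huv => ?_) i j)
  · exact bipartiteDist_le_of_adj (isSemimetric_distanceMatrix hc)
      (fun i j hij => distanceMatrix_le_weight (φ := fun _ => c) hij) i j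
  · rcases u with u | u <;> rcases v with v | v <;> simp [bipartiteDist] at huv ⊢

/-- A semimetric bounded by four is extended by a point at distance two from everything else. -/
def coneDist {W : Type*} (d : Matrix W W ℝ) : Matrix (Option W) (Option W) ℝ :=
  Matrix.of fun i j => match i, j with
    | none, none => 0
    | some i, some j => d i j
    | _, _ => 2

theorem IsSemimetric.coneDist {W : Type*} {d : Matrix W W ℝ} (hd : IsSemimetric d)
    (h : ∀ i j, d i j ≤ 4) : IsSemimetric (coneDist d) := by
  refine ⟨?_, ?_, ?_⟩
  · rintro (_ | u)
    · rfl
    · exact hd.self u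
  · rintro (_ | u) (_ | v) <;> first | rfl | exact hd.symm u v
  · rintro (_ | u) (_ | v) (_ | x) <;> simp only [WeightedGraph.coneDist, Matrix.of_apply] <;>
      try norm_num
    · exact hd.nonneg _ _
    · linarith [h u x]
    · exact hd.nonneg _ _
    · exact hd.triangle u v x

/-- A complete bipartite graph minor can be weighted so as to appear isometrically. -/
theorem IsGraphMinor.exists_isometric {α β : Type*} [DecidableEq α] [DecidableEq β] [Nonempty α]
    [Nonempty β] [Fintype V] [DecidableEq V]
    (hG : G.Connected) (h : IsGraphMinor (completeBipartiteGraph α β) G) :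
    ∃ (φ : G.edgeSet → ℝ≥0) (f : α ⊕ β ↪ V),
      (distanceMatrix G φ).submatrix f f = bipartiteDist α β := by
  classical
  obtain ⟨B, hconn, hdisj, hadj⟩ := h
  have hb := isSemimetric_bipartiteDist α β
  have h4 : ∀ i j, bipartiteDist α β i j ≤ 4 := fun i j => by
    simp only [bipartiteDist, Matrix.of_apply]
    split_ifs <;> norm_num
  let κ : V → Option (α ⊕ β) := fun v => if h : ∃ w, v ∈ B w then some h.choose else none
  have hκ : ∀ w, ∀ v ∈ B w, κ v = some w := by
    intro w v hv
    have h : ∃ w, v ∈ B w := ⟨w, hv⟩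
    simp only [κ, dif_pos h, Option.some.injEq]
    by_contra hne
    exact Set.disjoint_left.mp (hdisj _ _ hne) h.choose_spec hv
  -- Weights are pulled back from `K_{2,3}`-like distances: zero inside a branch set, the bipartite
  -- distance between branch sets, and two from a branch set to unused vertices, so a detour through
  -- unused vertices is no shortcut.
  have hδ := (hb.coneDist h4).comap κ
  obtain ⟨φ, hφ⟩ := hδ.exists_weight G
  have hD := isSemimetric_distanceMatrix (φ := φ) hG
  have hDle : ∀ x y, G.Adj x y → ∀ w w', x ∈ B w → y ∈ B w' →
      distanceMatrix G φ x y ≤ bipartiteDist α β w w' := by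
    intro x y hxy w w' hx hy
    have := distanceMatrix_le_weight (φ := φ) hxy
    rw [hφ x y hxy, Matrix.submatrix_apply, hκ w x hx, hκ w' y hy] at this
    exact this
  have hzero : ∀ w, ∀ x ∈ B w, ∀ y ∈ B w, distanceMatrix G φ x y ≤ 0 := by
    intro w
    have : ∀ {x y : B w} (p : (G.induce (B w)).Walk x y), distanceMatrix G φ x y ≤ 0 := by
      intro x y p
      induction p with
      | nil => exact (hD.self _).le
      | @cons a b c hab p ih =>
        have := hDle a b hab w w a.2 b.2
        rw [hb.self] at this
        exact (hD.triangle _ _ _).trans (add_nonpos this ih)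
    intro x hx y hy
    exact this ((hconn w).preconnected ⟨x, hx⟩ ⟨y, hy⟩).some
  let f : ∀ w, B w := fun w => (hconn w).nonempty.some
  have f' : ∀ w, ((f w : B w) : V) ∈ B w := fun w => (f w).2
  refine ⟨φ, ⟨fun w => f w, fun w w' hww => ?_⟩, ?_⟩
  · by_contra hne
    have h2 := f' w'
    rw [← show ((f w : B w) : V) = f w' from hww] at h2
    exact Set.disjoint_left.mp (hdisj _ _ hne) (f' w) h2
  · ext i j
    refine le_antisymm ?_ ?_
    · have := bipartiteDist_le_of_adj (hD.comap fun w => ((f w : B w) : V)) (c := 1) (fun i j hij => ?_) i j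
      · rwa [one_mul] at this
      · obtain ⟨x, hx, y, hy, hxy⟩ := hadj i j hij
        have h1 := hDle x y hxy i j hx hy
        have h2 := hzero i _ (f' i) x hx
        have h3 := hzero j y hy _ (f' j)
        have e : bipartiteDist α β i j = 1 := by
          rcases i with i | i <;> rcases j with j | j <;> simp [bipartiteDist] at hij ⊢
        have h4 := hD.triangle (f i) x (f j)
        have h5 := hD.triangle x y (f j)
        rw [Matrix.submatrix_apply]
        linarith
    · have := hδ.le_distanceMatrix hG (fun u v huv => (hφ u v huv).ge) (f i) (f j)
      rw [Matrix.submatrix_apply, hκ i _ (f' i), hκ j _ (f' j)] at this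
      exact this

end

/-! ### Negative type, `ℓ₁` and positive eigenvalues -/

section
variable {V : Type*} [Fintype V]

/-- The quadratic form of a matrix. -/
def quadForm (d : Matrix V V ℝ) (x : V → ℝ) : ℝ := ∑ u, ∑ v, x u * x v * d u v

/-- The quadratic form is nonpositive on the vectors with zero sum. -/
def IsNegativeType (d : Matrix V V ℝ) : Prop := ∀ x : V → ℝ, ∑ u, x u = 0 → quadForm d x ≤ 0

theorem quadForm_eq_dotProduct (d : Matrix V V ℝ) (x : V → ℝ) :
    quadForm d x = x ⬝ᵥ d.mulVec x := by
  simp only [quadForm, dotProduct, Matrix.mulVec, Finset.mul_sum]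
  exact Finset.sum_congr rfl fun u _ => Finset.sum_congr rfl fun v _ => by ring

theorem quadForm_sum {ι : Type*} (s : Finset ι) (c : ι → ℝ) (d : ι → Matrix V V ℝ) (x : V → ℝ) :
    quadForm (∑ k ∈ s, c k • d k) x = ∑ k ∈ s, c k * quadForm (d k) x := by
  simp only [quadForm, Matrix.sum_apply, Matrix.smul_apply, smul_eq_mul, Finset.mul_sum]
  rw [Finset.sum_comm' (t' := Finset.univ) (s' := fun _ => s) (by simp)]
  refine Finset.sum_congr rfl fun u _ => ?_
  rw [Finset.sum_comm]
  exact Finset.sum_congr rfl fun v _ => Finset.sum_congr rfl fun k _ => by ring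

theorem IsNegativeType.sum {ι : Type*} {s : Finset ι} {c : ι → ℝ} {d : ι → Matrix V V ℝ}
    (hc : ∀ k ∈ s, 0 ≤ c k) (hd : ∀ k ∈ s, IsNegativeType (d k)) :
    IsNegativeType (∑ k ∈ s, c k • d k) := by
  intro x hx
  rw [quadForm_sum]
  exact Finset.sum_nonpos fun k hk => mul_nonpos_of_nonneg_of_nonpos (hc k hk) (hd k hk x hx)

/-- The distance of points on the line is of negative type. -/
theorem isNegativeType_abs_sub (a : V → ℝ) : IsNegativeType (Matrix.of fun u v => |a u - a v|) := by
  intro x hx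
  obtain ⟨b, hb⟩ := (Set.finite_range a).bddBelow
  have hb' : ∀ u, b ≤ a u := fun u => hb ⟨u, rfl⟩
  -- The measures `min (a u) (a v) - b` of intersections of intervals form a Gram matrix. The
  -- distance is minus twice this plus terms in one variable, which vanish on zero-sum vectors.
  have hpsd := MeasureTheory.posSemidef_matrix_measure_inter (μ := MeasureTheory.volume)
    (s := fun u => Set.Ioc b (a u)) (fun u => measurableSet_Ioc) fun u => by simp
  have h := hpsd.dotProduct_mulVec_nonneg x
  have e : ∀ u v, MeasureTheory.volume.real (Set.Ioc b (a u) ∩ Set.Ioc b (a v)) =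
      min (a u) (a v) - b := by
    intro u v
    rw [Set.Ioc_inter_Ioc, Real.volume_real_Ioc, max_self]
    exact max_eq_left (sub_nonneg.mpr (le_min (hb' u) (hb' v)))
  have q : ∀ u v, |a u - a v| = (a u - b) + (a v - b) - 2 * (min (a u) (a v) - b) := by
    intro u v
    rcases le_total (a u) (a v) with h | h
    · rw [abs_of_nonpos (by linarith), min_eq_left h]; ring
    · rw [abs_of_nonneg (by linarith), min_eq_right h]; ring
  have h1 : quadForm (Matrix.of fun u v => |a u - a v|) x =
      2 * (∑ u, x u * (a u - b)) * (∑ v, x v) -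
        2 * ∑ u, x u * ∑ v, (min (a u) (a v) - b) * x v := by
    have : ∀ u, ∑ v, x u * x v * |a u - a v| = x u * (a u - b) * ∑ v, x v +
        x u * ∑ v, x v * (a v - b) - 2 * (x u * ∑ v, (min (a u) (a v) - b) * x v) := by
      intro u
      simp only [Finset.mul_sum, ← Finset.sum_add_distrib, ← Finset.sum_sub_distrib]
      exact Finset.sum_congr rfl fun v _ => by rw [q]; ring
    simp only [quadForm, Matrix.of_apply, this, Finset.sum_sub_distrib, Finset.sum_add_distrib,
      ← Finset.mul_sum, ← Finset.sum_mul]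
    ring
  simp only [dotProduct, Matrix.mulVec, Matrix.of_apply, e, star_trivial] at h
  rw [h1, hx]
  linarith

theorem isNegativeType_cutMetric [DecidableEq V] (S : Finset V) : IsNegativeType (cutMetric S) := by
  convert isNegativeType_abs_sub (fun u => if u ∈ S then (1 : ℝ) else 0) using 1
  ext u v
  simp only [cutMetric, Matrix.of_apply]
  by_cases hu : u ∈ S <;> by_cases hv : v ∈ S <;> simp [hu, hv]

theorem L1Embeddable.isNegativeType {d : Matrix V V ℝ} (h : L1Embeddable d) : IsNegativeType d := by
  classical
  obtain ⟨f, hf⟩ := h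
  have e : d = ∑ n ∈ Finset.univ.biUnion (fun u => (f u).support),
      (1 : ℝ) • Matrix.of fun u v => |f u n - f v n| := by
    ext u v
    rw [hf, Matrix.sum_apply, Finsupp.sum]
    simp only [one_smul, Matrix.of_apply, Finsupp.coe_sub, Pi.sub_apply]
    refine Finset.sum_subset (fun n hn => ?_) fun n _ hn => ?_
    · rcases Finset.mem_union.mp (Finsupp.support_sub hn) with h | h
      · exact Finset.mem_biUnion.mpr ⟨u, Finset.mem_univ _, h⟩
      · exact Finset.mem_biUnion.mpr ⟨v, Finset.mem_univ _, h⟩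
    · simpa using hn
  rw [e]
  exact .sum (fun _ _ => zero_le_one) fun n _ => isNegativeType_abs_sub fun u => f u n

theorem L1Embeddable.of_sum_cutMetric [DecidableEq V] {d : Matrix V V ℝ} {c : Finset V → ℝ}
    (hc : ∀ S, 0 ≤ c S) (h : d = ∑ S, c S • cutMetric S) : L1Embeddable d := by
  classical
  let e := Fintype.equivFin (Finset V)
  -- One coordinate per set `S`, with value `c S` on `S` and `0` off it.
  refine ⟨fun u => ∑ S, Finsupp.single (e S : ℕ) (if u ∈ S then c S else 0), fun u v => ?_⟩
  have hd : (∑ S, Finsupp.single (e S : ℕ) (if u ∈ S then c S else 0)) -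
      (∑ S, Finsupp.single (e S : ℕ) (if v ∈ S then c S else 0)) =
      ∑ S, Finsupp.single (e S : ℕ) ((if u ∈ S then c S else 0) - if v ∈ S then c S else 0) := by
    rw [← Finset.sum_sub_distrib]
    exact Finset.sum_congr rfl fun S _ => (Finsupp.single_sub _ _ _).symm
  have inj : Function.Injective fun S : Finset V => (e S : ℕ) :=
    Fin.val_injective.comp e.injective
  have hval : ∀ (g : Finset V → ℝ) (T : Finset V),
      (∑ S, Finsupp.single (e S : ℕ) (g S)) (e T : ℕ) = g T := by
    intro g T
    rw [Finsupp.finsetSum_apply, Finset.sum_eq_single T]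
    · simp
    · intro S _ hST
      exact Finsupp.single_eq_of_ne fun h => hST (inj h.symm)
    · simp
  rw [hd, Finsupp.sum_of_support_subset (s := Finset.univ.image fun S : Finset V => (e S : ℕ)),
    Finset.sum_image inj.injOn]
  · simp only [hval, h, Matrix.sum_apply]
    refine Finset.sum_congr rfl fun S _ => ?_
    by_cases hu : u ∈ S <;> by_cases hv : v ∈ S <;>
      simp [cutMetric, hu, hv, abs_of_nonneg (hc S)]
  · intro n hn
    obtain ⟨S, hS, hn⟩ := Finset.mem_biUnion.mp (Finsupp.support_finsetSum hn)
    have := Finsupp.support_single_subset hn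
    rw [Finset.mem_singleton] at this
    exact Finset.mem_image.mpr ⟨S, hS, this.symm⟩
  · simp

theorem TotallyDecomposable.l1Embeddable [DecidableEq V] {d : Matrix V V ℝ}
    (h : TotallyDecomposable d) : L1Embeddable d := by
  refine .of_sum_cutMetric (c := fun S => 1 / 2 * isolationIndex d S)
    (fun S => mul_nonneg (by norm_num) (isolationIndex_nonneg d S)) ?_
  have := sub_eq_zero.mp h
  rw [sum_splitSets, Finset.smul_sum] at this
  simpa only [smul_smul] using this

section pushforward
variable {W : Type*} [Fintype W] [DecidableEq V]

/-- The push-forward of a vector along a map of index sets. -/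
def pushVec (f : W → V) (x : W → ℝ) (v : V) : ℝ := ∑ i, if f i = v then x i else 0

theorem sum_pushVec_mul (f : W → V) (x : W → ℝ) (g : V → ℝ) :
    ∑ v, pushVec f x v * g v = ∑ i, x i * g (f i) := by
  simp only [pushVec, Finset.sum_mul]
  rw [Finset.sum_comm]
  refine Finset.sum_congr rfl fun i _ => ?_
  simp

theorem quadForm_pushVec (d : Matrix V V ℝ) (f : W → V) (x : W → ℝ) :
    quadForm d (pushVec f x) = quadForm (d.submatrix f f) x := by
  simp only [quadForm, mul_assoc, ← Finset.mul_sum, sum_pushVec_mul, Matrix.submatrix_apply]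

theorem IsNegativeType.submatrix {d : Matrix V V ℝ} (h : IsNegativeType d) (f : W → V) :
    IsNegativeType (d.submatrix f f) := by
  intro x hx
  rw [← quadForm_pushVec]
  apply h
  have := sum_pushVec_mul f x fun _ => 1
  simpa [hx] using this

end pushforward

theorem not_isNegativeType_smul_bipartiteDist {c : ℝ} (hc : 0 < c) :
    ¬ IsNegativeType (c • bipartiteDist (Fin 2) (Fin 3)) := by
  intro h
  -- On this zero-sum vector the form is `36 + 48 - 72 = 12`, times `c`.
  have := h (Sum.elim (fun _ => 3) fun _ => -2) (by norm_num)
  simp [quadForm, bipartiteDist, Fin.sum_univ_succ] at this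
  linarith

section inertia
variable [DecidableEq V] {d : Matrix V V ℝ}

theorem posInertia_eq_card (hd : d.IsHermitian) :
    posInertia d = (Finset.univ.filter fun i => 0 < hd.eigenvalues i).card := by
  unfold posInertia
  rw [hd.roots_charpoly_eq_eigenvalues, Multiset.countP_map]
  rfl

theorem dotProduct_eigenvector (hd : d.IsHermitian) (i j : V) :
    (hd.eigenvectorBasis i : V → ℝ) ⬝ᵥ (hd.eigenvectorBasis j : V → ℝ) = if i = j then 1 else 0 := by
  have := orthonormal_iff_ite.mp hd.eigenvectorBasis.orthonormal i j
  rw [← this, EuclideanSpace.inner_eq_star_dotProduct, dotProduct_comm]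
  simp

theorem quadForm_eq_sum_eigenvalues (hd : d.IsHermitian) (x : V → ℝ) :
    quadForm d x = ∑ i, hd.eigenvalues i * (x ⬝ᵥ (hd.eigenvectorBasis i : V → ℝ)) ^ 2 := by
  have hx : x = ∑ i, (x ⬝ᵥ (hd.eigenvectorBasis i : V → ℝ)) • (hd.eigenvectorBasis i : V → ℝ) := by
    have := hd.eigenvectorBasis.sum_repr' (WithLp.toLp 2 x)
    have := congrArg (fun y : EuclideanSpace ℝ V => (y : V → ℝ)) this
    simp only [EuclideanSpace.inner_eq_star_dotProduct, WithLp.ofLp_sum, WithLp.ofLp_smul,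
      star_trivial] at this
    exact this.symm
  have hm : d.mulVec x = ∑ i, (x ⬝ᵥ (hd.eigenvectorBasis i : V → ℝ)) •
      (hd.eigenvalues i • (hd.eigenvectorBasis i : V → ℝ)) := by
    conv_lhs => rw [hx]
    rw [Matrix.mulVec_sum]
    refine Finset.sum_congr rfl fun i _ => ?_
    rw [Matrix.mulVec_smul, hd.mulVec_eigenvectorBasis]
  rw [quadForm_eq_dotProduct, hm, dotProduct_sum]
  refine Finset.sum_congr rfl fun i _ => ?_
  rw [dotProduct_smul, dotProduct_smul, smul_eq_mul, smul_eq_mul]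
  ring

/-- If there is one positive eigenvalue, the form is nonpositive on a hyperplane. -/
theorem exists_quadForm_nonpos_of_posInertia_eq_one (hd : d.IsHermitian) (h : posInertia d = 1) :
    ∃ y : V → ℝ, ∀ x : V → ℝ, ∑ v, x v * y v = 0 → quadForm d x ≤ 0 := by
  rw [posInertia_eq_card hd, Finset.card_eq_one] at h
  obtain ⟨i, hi⟩ := h
  refine ⟨hd.eigenvectorBasis i, fun x hx => ?_⟩
  rw [quadForm_eq_sum_eigenvalues hd]
  refine Finset.sum_nonpos fun j _ => ?_
  by_cases hj : j = i
  · subst hj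
    rw [show x ⬝ᵥ (hd.eigenvectorBasis j : V → ℝ) = 0 from hx]
    simp
  · have : hd.eigenvalues j ≤ 0 := by
      by_contra! h
      have : j ∈ Finset.univ.filter fun i => 0 < hd.eigenvalues i := by simpa using h
      rw [hi, Finset.mem_singleton] at this
      exact hj this
    exact mul_nonpos_of_nonpos_of_nonneg this (sq_nonneg _)

theorem IsNegativeType.posInertia_eq_one (hn : IsNegativeType d) (hd : IsSemimetric d)
    (h0 : d ≠ 0) : posInertia d = 1 := by
  have hH : d.IsHermitian := by
    ext u v
    simp [hd.symm u v]
  rw [posInertia_eq_card hH]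
  apply le_antisymm
  · rw [Finset.card_le_one]
    intro i hi j hj
    simp only [Finset.mem_filter, Finset.mem_univ, true_and] at hi hj
    by_contra hij
    -- The plane of two eigenvectors with positive eigenvalues meets the zero-sum hyperplane, where
    -- the form would be positive.
    obtain ⟨a, b, hab, hs⟩ : ∃ a b : ℝ, (a ≠ 0 ∨ b ≠ 0) ∧
        a * (∑ v, hH.eigenvectorBasis i v) + b * (∑ v, hH.eigenvectorBasis j v) = 0 := by
      by_cases h : ∑ v, hH.eigenvectorBasis i v = 0
      · exact ⟨1, 0, Or.inl one_ne_zero, by simp [h]⟩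
      · exact ⟨-∑ v, hH.eigenvectorBasis j v, ∑ v, hH.eigenvectorBasis i v, Or.inr h, by ring⟩
    have := hn (a • (hH.eigenvectorBasis i : V → ℝ) + b • (hH.eigenvectorBasis j : V → ℝ)) (by
      simp only [Pi.add_apply, Pi.smul_apply, smul_eq_mul, Finset.sum_add_distrib,
        ← Finset.mul_sum]
      exact hs)
    rw [quadForm_eq_dotProduct, Matrix.mulVec_add, Matrix.mulVec_smul, Matrix.mulVec_smul,
      hH.mulVec_eigenvectorBasis, hH.mulVec_eigenvectorBasis] at this
    simp only [add_dotProduct, dotProduct_add, smul_dotProduct, dotProduct_smul,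
      dotProduct_eigenvector, hij, Ne.symm hij, if_true, if_false, smul_eq_mul] at this
    rcases hab with h | h <;> have := sq_pos_of_ne_zero h <;>
      nlinarith [mul_nonneg hi.le (sq_nonneg a), mul_nonneg hj.le (sq_nonneg b)]
  · rw [Nat.succ_le_iff, Finset.card_pos]
    by_contra h
    rw [Finset.not_nonempty_iff_eq_empty, Finset.filter_eq_empty_iff] at h
    apply h0
    ext u v
    -- With no positive eigenvalue the form is nonpositive at `e_u + e_v`, where it equals `2 d(u,
    -- v)`.
    have := quadForm_eq_sum_eigenvalues hH (pushVec ![u, v] fun _ => 1)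
    rw [quadForm_pushVec] at this
    have hle : quadForm (d.submatrix ![u, v] ![u, v]) (fun _ => 1) ≤ 0 := by
      rw [this]
      exact Finset.sum_nonpos fun i _ =>
        mul_nonpos_of_nonpos_of_nonneg (not_lt.mp (h (Finset.mem_univ i))) (sq_nonneg _)
    simp [quadForm, hd.self, hd.symm v u] at hle
    exact le_antisymm hle (hd.nonneg u v)

end inertia
end

/-! ### Distance minors and the obstruction from `K_{2,3}` -/

section
variable {V : Type*} [Fintype V] [DecidableEq V]

theorem isDistanceMinor_of_submatrix {W : Type*} {d : Matrix V V ℝ} (f : W ↪ V) :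
    IsDistanceMinor (d.submatrix f f) d := by
  -- These coefficients rebuild `d` itself; the half is there because every split is listed twice.
  refine ⟨1, fun S => (1 / 2 * isolationIndex d S).toNNReal, f, ?_⟩
  congr 1
  have e : ∀ S, ((1 / 2 * isolationIndex d S).toNNReal : ℝ) • cutMetric S =
      (1 / 2 : ℝ) • isolationIndex d S • cutMetric S := by
    intro S
    rw [Real.coe_toNNReal _ (mul_nonneg (by norm_num) (isolationIndex_nonneg d S)), smul_smul]
  simp only [e, NNReal.coe_one, one_smul, splitPrimePart, Finset.smul_sum, sub_add_cancel]

theorem TotallyDecomposable.isNegativeType_of_isDistanceMinor {W : Type*} [Fintype W]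
    [DecidableEq W] {d : Matrix V V ℝ} {d' : Matrix W W ℝ} (h : TotallyDecomposable d)
    (h' : IsDistanceMinor d' d) : IsNegativeType d' := by
  obtain ⟨l₀, l, f, rfl⟩ := h'
  rw [show splitPrimePart d = 0 from h, smul_zero, zero_add]
  exact (IsNegativeType.sum (fun S _ => (l S).2)
    fun S _ => isNegativeType_cutMetric S).submatrix f

theorem posInertia_ne_one_of_submatrix {d : Matrix V V ℝ} (hd : d.IsHermitian)
    (f : Fin 2 ⊕ Fin 3 → V) (h : d.submatrix f f = bipartiteDist (Fin 2) (Fin 3)) :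
    posInertia d ≠ 1 := by
  intro h1
  obtain ⟨y, hy⟩ := exists_quadForm_nonpos_of_posInertia_eq_one hd h1
  set p := y (f (.inl 0)) + y (f (.inl 1))
  set q := y (f (.inr 0)) + (y (f (.inr 1)) + y (f (.inr 2)))
  -- The plane of vectors constant on each side, where the form is positive definite, meets the
  -- hyperplane orthogonal to `y` nontrivially.
  obtain ⟨s, t, hst, hs⟩ : ∃ s t : ℝ, (s ≠ 0 ∨ t ≠ 0) ∧ s * p + t * q = 0 := by
    by_cases hp : p = 0
    · exact ⟨1, 0, Or.inl one_ne_zero, by simp [hp]⟩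
    · exact ⟨-q, p, Or.inr hp, by ring⟩
  have := hy (pushVec f (Sum.elim (fun _ => s) fun _ => t)) (by
    rw [sum_pushVec_mul, ← hs]
    simp [Fin.sum_univ_succ, p, q]
    ring)
  rw [quadForm_pushVec, h] at this
  have e : quadForm (bipartiteDist (Fin 2) (Fin 3)) (Sum.elim (fun _ => s) fun _ => t) =
      4 * (s + 3 / 2 * t) ^ 2 + 3 * t ^ 2 := by
    simp [quadForm, bipartiteDist, Fin.sum_univ_succ]
    ring
  rw [e] at this
  have ht : t = 0 := by
    have := sq_nonneg (s + 3 / 2 * t)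
    exact pow_eq_zero_iff two_ne_zero |>.mp (le_antisymm (by linarith) (sq_nonneg t))
  subst ht
  have hs0 : s = 0 := pow_eq_zero_iff two_ne_zero |>.mp (le_antisymm (by nlinarith) (sq_nonneg s))
  simp [hs0] at hst

end
end WeightedGraph

end

theorem theorem3p7 {V : Type*} [Fintype V] [DecidableEq V] (G : SimpleGraph V)
    (hG : G.Connected) :
    List.TFAE
      [¬ IsGraphMinor (completeBipartiteGraph (Fin 2) (Fin 3)) G,
       ¬ ∃ (φ : G.edgeSet → ℝ≥0) (c : ℝ≥0), 0 < c ∧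
          IsDistanceMinor
            (distanceMatrix (completeBipartiteGraph (Fin 2) (Fin 3)) (fun _ => c))
            (distanceMatrix G φ),
       ∀ φ : G.edgeSet → ℝ≥0, TotallyDecomposable (distanceMatrix G φ),
       ∀ φ : G.edgeSet → ℝ≥0, L1Embeddable (distanceMatrix G φ),
       ∀ φ : G.edgeSet → ℝ≥0, distanceMatrix G φ ≠ 0 → posInertia (distanceMatrix G φ) = 1] := by
  tfae_have 1 → 3 := fun h φ => by
    refine totallyDecomposable_of_weaklyDecomposableOn
      (weaklyDecomposableOn_of_geodesicOn (isSemimetric_distanceMatrix hG) h _ ?_)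
    rw [Finset.coe_univ]
    exact geodesicOn_distanceMatrix hG
  tfae_have 3 → 2 := by
    rintro h ⟨φ, c, hc, hm⟩
    rw [distanceMatrix_completeBipartiteGraph] at hm
    exact not_isNegativeType_smul_bipartiteDist (NNReal.coe_pos.mpr hc)
      ((h φ).isNegativeType_of_isDistanceMinor hm)
  tfae_have 2 → 1 := fun h hm => by
    obtain ⟨φ, f, hf⟩ := hm.exists_isometric hG
    refine h ⟨φ, 1, one_pos, ?_⟩
    rw [distanceMatrix_completeBipartiteGraph, NNReal.coe_one, one_smul, ← hf]
    exact isDistanceMinor_of_submatrix f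
  tfae_have 3 → 4 := fun h φ => (h φ).l1Embeddable
  tfae_have 4 → 5 := fun h φ h0 =>
    (h φ).isNegativeType.posInertia_eq_one (isSemimetric_distanceMatrix hG) h0
  tfae_have 5 → 1 := fun h hm => by
    obtain ⟨φ, f, hf⟩ := hm.exists_isometric hG
    have hd := isSemimetric_distanceMatrix (φ := φ) hG
    refine posInertia_ne_one_of_submatrix ?_ f hf (h φ fun h0 => ?_)
    · ext u v
      simp [hd.symm u v]
    · have := congrFun (congrFun hf (.inl 0)) (.inr 0)
      simp [h0, bipartiteDist] at this
  tfae_finish
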